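/- Fix a finite nonempty set $P$ of atomic propositions and a partition $\widetilde\Sigma=(\Sigma_c,\Sigma_r,\Sigma_l)$ of $2^P$ into calls, returns and local actions. Deterministic Pushdown Linear Dynamic Logic (DPLDL) has the formulas $$\varphi ::= p \mid \neg\varphi \mid \varphi\wedge\varphi \mid \varphi\vee\varphi \mid \langle\mathfrak A\rangle\varphi \mid [\mathfrak A]\varphi \qquad (p\in P),$$ where $\mathfrak A$ ranges over testing deterministic pushdown automata: a deterministic pushdown automaton (DPDA; $\varepsilon$-moves allowed, acceptance by final state) over the alphabet $2^P$, together with a partial function $t$ from its states to (previously formed) formulas. For an infinite word $\alpha=\alpha_0\alpha_1\cdots$ over $2^P$ and a position $k$, $(\alpha,k)\models p$ iff $p\in\alpha_k$, Boolean connectives are as usual, and $(\alpha,k)\models\langle\mathfrak A\rangle\varphi$ (resp. $[\mathfrak A]\varphi$) iff some (resp. every) $l\ge k$ with $(k,l)\in\mathcal R_{\mathfrak A}(\alpha)$ satisfies $(\alpha,l)\models\varphi$. Here $(k,l)\in\mathcal R_{\mathfrak A}(\alpha)$ iff $\mathfrak A$ has an initial accepting run on $\alpha_k\cdots\alpha_{l-1}$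 such that, whenever the run is in a state $q\in\mathrm{dom}(t)$ at position $m$, $(\alpha,m)\models t(q)$. A word $\alpha$ is a model of $\varphi$ if $(\alpha,0)\models\varphi$. A visibly pushdown system (VPS) over $\widetilde\Sigma$ has finitely many states, a stack alphabet with an irremovable bottom marker $\bot$, and finitely many transitions that push one symbol when reading a call, pop one symbol when reading a return (leaving the stack $\bot$ unchanged when it is empty), and leave the stack unchanged when reading a local action. A pushdown system has finitely many transitions $(q,A,a,q',\beta)$ with $a\in 2^P$ and $|\beta|\le 2$, which replace the topmost stack symbol $A$ by $\beta$; stack contents always have the form $\gamma\bot$ with no $\bot$ in $\gamma$. In a (visibly) pushdown game, the two players move along the edges of the configuration graph of a (visibly) pushdown system, starting from $(q_I,\bot)$ for a given initial state $q_I$; the states are partitioned into those of Player 0 and those of Player 1, and the owner of the current state chooses the next edge. A strategy for a player must assign a legal move to every history ending in one of that player's vertices. Player 0 wins an infinite play if the sequence of its edge labels is a model of the winning condition, a DPLDL formula; she wins the game if she has a strategy such that all consistent infinite plays from the initial configuration are won by her. Then each of the following decision problems is undecidable: 1. (Validity) Given a DPLDL formula $\varphi$, is every infinite word over $2^P$ a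 model of $\varphi$? 2. (Model checking) Given a VPS $\mathcal S$ over $\widetilde\Sigma$, a state $q_I$ of $\mathcal S$, and a DPLDL formula $\varphi$, is the label sequence of every infinite run of $\mathcal S$ from $(q_I,\bot)$ a model of $\varphi$? 3. (Pushdown games) Given a pushdown game with a DPLDL winning condition, does Player 0 win it? 4. (Visibly pushdown games) Given a visibly pushdown game over $\widetilde\Sigma$ with a DPLDL winning condition, does Player 0 win it? -/

import Mathlib

/-! # Deterministic Pushdown Linear Dynamic Logic and its decision problems -/

namespace DPLDL

/-- A letter over the atomic propositions `P = Fin n`, i.e. an element of `2^P`. -/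
abbrev Letter (n : ℕ) : Type := Finset (Fin n)

/-- An infinite word over `2^P`. -/
abbrev Word (n : ℕ) : Type := ℕ → Letter n

/-! ## Deterministic pushdown automata -/

/-- A transition of a pushdown automaton with states `Fin k` and stack symbols `Fin g`: in state
`src` with `top` on top of the stack, read `inp` (`none` is the empty word), go to `dst`, and
replace `top` by the word `push` (leftmost symbol on top). -/
structure Trans (n k g : ℕ) where
  src : Fin k
  inp : Option (Letter n)
  top : Fin g
  dst : Fin k
  push : List (Fin g)

/-- A deterministic pushdown automaton over `2^P`, with acceptance by final states. The finite
transition relation is given by a list; at most one transition is ever applicable, so there is at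
most one move for each letter, and no letter can be read when a spontaneous move is possible. -/
structure DPDA (n k g : ℕ) where
  trans : List (Trans n k g)
  init : Fin k
  bottom : Fin g
  final : Finset (Fin k)
  det : ∀ τ ∈ trans, ∀ τ' ∈ trans, τ.src = τ'.src → τ.top = τ'.top →
    (τ.inp = τ'.inp ∨ τ.inp = none ∨ τ'.inp = none) → τ = τ'

namespace DPDA

variable {n k g : ℕ}

/-- A configuration of an automaton reading an infinite word: the position of the next letter, the
state, and the stack content from top to bottom. -/
structure Conf (k g : ℕ) where
  pos : ℕ
  state : Fin k
  stack : List (Fin g)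

/-- One move of `A` on the infinite word `α`. -/
def Step (A : DPDA n k g) (α : Word n) (c c' : Conf k g) : Prop :=
  ∃ τ ∈ A.trans, ∃ rest : List (Fin g),
    τ.src = c.state ∧ τ.dst = c'.state ∧
    c.stack = τ.top :: rest ∧ c'.stack = τ.push ++ rest ∧
    ((τ.inp = some (α c.pos) ∧ c'.pos = c.pos + 1) ∨ (τ.inp = none ∧ c'.pos = c.pos))

/-- `(i, l) ∈ R_A(α)`: there is an initial accepting run of `A` on `α_i ⋯ α_{l-1}` such that every
configuration of the run, in state `q` and at position `m`, say, satisfies the test `T m q`. -/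
def Accepts (A : DPDA n k g) (α : Word n) (T : ℕ → Fin k → Prop) (i l : ℕ) : Prop :=
  T i A.init ∧
  ∃ c : Conf k g, c.pos = l ∧ c.state ∈ A.final ∧
    Relation.ReflTransGen (fun d d' => A.Step α d d' ∧ T d'.pos d'.state)
      ⟨i, A.init, [A.bottom]⟩ c

end DPDA

/-! ## Formulas -/

/-- DPLDL formulas over `P = Fin n`. The guards of `dia` and `box` are testing automata: a DPDA `A`
together with a partial function `t`, with domain `D`, from its states to formulas. -/
inductive Formula (n : ℕ) : Type
  | atom (p : Fin n) : Formula n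
  | neg (φ : Formula n) : Formula n
  | and (φ ψ : Formula n) : Formula n
  | or (φ ψ : Formula n) : Formula n
  | dia {k g : ℕ} (A : DPDA n k g) (D : Finset (Fin k)) (t : {q // q ∈ D} → Formula n)
      (φ : Formula n) : Formula n
  | box {k g : ℕ} (A : DPDA n k g) (D : Finset (Fin k)) (t : {q // q ∈ D} → Formula n)
      (φ : Formula n) : Formula n

namespace Formula

variable {n : ℕ}

/-- `φ.Sat α i` is `(α, i) ⊨ φ`. -/
def Sat (α : Word n) : Formula n → ℕ → Prop
  | atom p, i => p ∈ α i
  | neg φ, i => ¬ Sat α φ i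
  | and φ ψ, i => Sat α φ i ∧ Sat α ψ i
  | or φ ψ, i => Sat α φ i ∨ Sat α ψ i
  | dia A D t φ, i =>
      ∃ l, i ≤ l ∧ A.Accepts α (fun m q => ∀ h : q ∈ D, Sat α (t ⟨q, h⟩) m) i l ∧ Sat α φ l
  | box A D t φ, i =>
      ∀ l, i ≤ l → A.Accepts α (fun m q => ∀ h : q ∈ D, Sat α (t ⟨q, h⟩) m) i l → Sat α φ l

/-- `α ⊨ φ`. -/
def Models (α : Word n) (φ : Formula n) : Prop := φ.Sat α 0

/-- All words are models of `φ`. -/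
def Valid (φ : Formula n) : Prop := ∀ α : Word n, Models α φ

end Formula

/-! ## Visibly pushdown systems -/

/-- The three parts of a pushdown alphabet. -/
inductive LetterKind : Type
  | call
  | ret
  | loc

/-- A visibly pushdown system with states `Fin k` over the pushdown alphabet given by the partition
`kind` of `2^P`. The stack alphabet is `Option (Fin g)`, where `none` is the stack-bottom marker `⊥`
and `Fin g` are the other symbols. The transition relation is given by three lists, for calls
`(q, a, q', A)`, returns `(q, a, A, q')` and local actions `(q, a, q')`. -/
structure VPS {n : ℕ} (kind : Letter n → LetterKind) (k g : ℕ) where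
  callTrans : List (Fin k × Letter n × Fin k × Fin g)
  retTrans : List (Fin k × Letter n × Option (Fin g) × Fin k)
  locTrans : List (Fin k × Letter n × Fin k)
  call_kind : ∀ τ ∈ callTrans, kind τ.2.1 = LetterKind.call
  ret_kind : ∀ τ ∈ retTrans, kind τ.2.1 = LetterKind.ret
  loc_kind : ∀ τ ∈ locTrans, kind τ.2.1 = LetterKind.loc

/-- A configuration `(q, γ⊥)`; the bottom marker is left implicit, the stack `γ ∈ (Γ \ {⊥})^*` is
written from top to bottom. -/
abbrev SysConf (k g : ℕ) : Type := Fin k × List (Fin g)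

/-- `S.Edge c a c'`: the configuration graph has an `a`-labeled edge from `c` to `c'`. -/
def VPS.Edge {n : ℕ} {kind : Letter n → LetterKind} {k g : ℕ} (S : VPS kind k g)
    (c : SysConf k g) (a : Letter n) (c' : SysConf k g) : Prop :=
  (∃ A, (c.1, a, c'.1, A) ∈ S.callTrans ∧ c'.2 = A :: c.2) ∨
  ((c.1, a, none, c'.1) ∈ S.retTrans ∧ c.2 = [] ∧ c'.2 = []) ∨
  (∃ A, (c.1, a, some A, c'.1) ∈ S.retTrans ∧ c.2 = A :: c'.2) ∨
  ((c.1, a, c'.1) ∈ S.locTrans ∧ c'.2 = c.2)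

/-- The label sequences of the infinite runs from `(q, ⊥)`. -/
def VPS.traces {n : ℕ} {kind : Letter n → LetterKind} {k g : ℕ} (S : VPS kind k g)
    (q : Fin k) : Set (Word n) :=
  {α | ∃ ρ : ℕ → SysConf k g, ρ 0 = (q, []) ∧ ∀ i, S.Edge (ρ i) (α i) (ρ (i + 1))}

/-- An instance of the model checking problem. -/
structure MCInstance {n : ℕ} (kind : Letter n → LetterKind) where
  k : ℕ
  g : ℕ
  S : VPS kind k g
  init : Fin k
  φ : Formula n

/-- The system satisfies the specification. -/
def MCInstance.Holds {n : ℕ} {kind : Letter n → LetterKind} (M : MCInstance kind) : Prop :=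
  M.S.traces M.init ⊆ {α | Formula.Models α M.φ}

/-! ## Two-player games -/

/-- A two-player game with labeled vertices. `V0` are the vertices of Player 0, all others are those
of Player 1; `Win` is the set of label sequences that are winning for Player 0. -/
structure Game (V L : Type) where
  V0 : Set V
  E : V → V → Prop
  init : V
  label : V → L
  Win : Set (ℕ → L)

namespace Game

variable {V L : Type}

/-- Initial plays. -/
def InitialPlay (G : Game V L) (π : ℕ → V) : Prop :=
  π 0 = G.init ∧ ∀ i, G.E (π i) (π (i + 1))

/-- `σ` is a strategy for Player 0; `σ w v` is the successor chosen at the end of `w · v`. -/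
def IsStrategy (G : Game V L) (σ : List V → V → V) : Prop :=
  ∀ w, ∀ v ∈ G.V0, G.E v (σ w v)

/-- The play `π` is consistent with the strategy `σ` for Player 0. -/
def Consistent (G : Game V L) (σ : List V → V → V) (π : ℕ → V) : Prop :=
  ∀ m, π m ∈ G.V0 → π (m + 1) = σ (List.ofFn fun i : Fin m => π i) (π m)

/-- Player 0 has a winning strategy. The label of the first vertex of a play is disregarded. -/
def PlayerZeroWins (G : Game V L) : Prop :=
  ∃ σ, G.IsStrategy σ ∧
    ∀ π, G.InitialPlay π → G.Consistent σ π → (fun i => G.label (π (i + 1))) ∈ G.Win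

end Game

/-- The game on the configuration graph `edge`: vertices are triples `(q, γ⊥, a)` where `a` is the
label of the last edge, and `Q0` are the states of Player 0. The letter of the initial vertex is
irrelevant, and taken to be `∅`. -/
def configGame {n k g : ℕ} (edge : SysConf k g → Letter n → SysConf k g → Prop)
    (Q0 : Finset (Fin k)) (q : Fin k) (φ : Formula n) : Game (SysConf k g × Letter n) (Letter n) where
  V0 := {v | v.1.1 ∈ Q0}
  E v v' := edge v.1 v'.2 v'.1
  init := ((q, []), ∅)
  label v := v.2
  Win := {α | Formula.Models α φ}

/-- A visibly pushdown game with a DPLDL winning condition. The states of Player 1 are those that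
are not in `Q0`. -/
structure VPGame {n : ℕ} (kind : Letter n → LetterKind) where
  k : ℕ
  g : ℕ
  S : VPS kind k g
  Q0 : Finset (Fin k)
  init : Fin k
  φ : Formula n

/-- Player 0 wins the visibly pushdown game. -/
def VPGame.PlayerZeroWins {n : ℕ} {kind : Letter n → LetterKind} (H : VPGame kind) : Prop :=
  (configGame H.S.Edge H.Q0 H.init H.φ).PlayerZeroWins

/-- A pushdown system with states `Fin k` and stack alphabet `Option (Fin g)`, where `none` is the
stack-bottom marker. A transition `(q, A, a, q', β)`, with `β` of length at most two, replaces
the topmost stack symbol `A` by `β`. -/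
structure PDS (n k g : ℕ) where
  trans : List (Fin k × Option (Fin g) × Letter n × Fin k × List (Option (Fin g)))
  len_le : ∀ τ ∈ trans, τ.2.2.2.2.length ≤ 2

/-- Labeled edges between configurations; on both sides, the stack content including the bottom
marker has the form `γ⊥` with no `⊥` in `γ`. -/
def PDS.Edge {n k g : ℕ} (S : PDS n k g)
    (c : SysConf k g) (a : Letter n) (c' : SysConf k g) : Prop :=
  ∃ (A : Option (Fin g)) (β rest : List (Option (Fin g))), (c.1, A, a, c'.1, β) ∈ S.trans ∧
    c.2.map some ++ [none] = A :: rest ∧ c'.2.map some ++ [none] = β ++ rest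

/-- A pushdown game with a DPLDL winning condition. -/
structure PDGame (n : ℕ) where
  k : ℕ
  g : ℕ
  S : PDS n k g
  Q0 : Finset (Fin k)
  init : Fin k
  φ : Formula n

/-- Player 0 wins the pushdown game. -/
def PDGame.PlayerZeroWins {n : ℕ} (H : PDGame n) : Prop :=
  (configGame H.S.Edge H.Q0 H.init H.φ).PlayerZeroWins

/-! ## Finite presentations as natural numbers -/

/-- A finite subset of `Fin m` as its list of bits. -/
def bits {m : ℕ} (s : Finset (Fin m)) : List Bool := List.ofFn fun i => decide (i ∈ s)

theorem bits_injective {m : ℕ} : Function.Injective (bits (m := m)) := by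
  intro s s' h
  have h' := List.ofFn_injective h
  ext i
  simpa using congrFun h' i

/-- A transition as a tuple of numbers. -/
def Trans.data {n k g : ℕ} (τ : Trans n k g) :
    ℕ × Option (List Bool) × ℕ × ℕ × List ℕ :=
  (τ.src.val, τ.inp.map bits, τ.top.val, τ.dst.val, τ.push.map Fin.val)

theorem Trans.data_injective {n k g : ℕ} : Function.Injective (Trans.data (n := n) (k := k) (g := g)) := by
  rintro ⟨q, a, X, q', β⟩ ⟨p, b, Y, p', β'⟩ h
  simp only [Trans.data, Prod.mk.injEq] at h
  obtain ⟨h1, h2, h3, h4, h5⟩ := h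
  rw [Fin.val_injective h1, Option.map_injective bits_injective h2, Fin.val_injective h3,
    Fin.val_injective h4, List.map_injective_iff.2 Fin.val_injective h5]

/-- The code of a deterministic pushdown automaton. -/
def DPDA.code {n k g : ℕ} (A : DPDA n k g) : ℕ :=
  Encodable.encode (k, g, A.trans.map Trans.data, A.init.val, A.bottom.val, bits A.final)

theorem DPDA.code_injective {n k g : ℕ} : Function.Injective (DPDA.code (n := n) (k := k) (g := g)) := by
  rintro ⟨Δ, q, Z, F, hd⟩ ⟨Δ', q', Z', F', hd'⟩ h
  have h := Encodable.encode_injective h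
  simp only [Prod.mk.injEq] at h
  obtain ⟨-, -, h1, h2, h3, h4⟩ := h
  obtain rfl := List.map_injective_iff.2 Trans.data_injective h1
  obtain rfl := Fin.val_injective h2
  obtain rfl := Fin.val_injective h3
  obtain rfl := bits_injective h4
  rfl

/-- The code of a formula. The test function is coded by the list of its values, where `0` stands
for an undefined value. -/
def Formula.code {n : ℕ} : Formula n → ℕ
  | atom p => Encodable.encode (0, p.val)
  | neg φ => Encodable.encode (1, code φ)
  | and φ ψ => Encodable.encode (2, code φ, code ψ)
  | or φ ψ => Encodable.encode (3, code φ, code ψ)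
  | dia (k := k) (g := g) A D t φ => Encodable.encode (4, k, g, A.code,
      (List.ofFn fun q : Fin k => if h : q ∈ D then code (t ⟨q, h⟩) + 1 else 0), code φ)
  | box (k := k) (g := g) A D t φ => Encodable.encode (5, k, g, A.code,
      (List.ofFn fun q : Fin k => if h : q ∈ D then code (t ⟨q, h⟩) + 1 else 0), code φ)

theorem Formula.code_tests {n k : ℕ} {D D' : Finset (Fin k)} {t : {q // q ∈ D} → Formula n}
    {t' : {q // q ∈ D'} → Formula n} (ih : ∀ q ψ, (t q).code = ψ.code → t q = ψ)
    (h : (List.ofFn fun q : Fin k => if h : q ∈ D then (t ⟨q, h⟩).code + 1 else 0) =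
      List.ofFn fun q : Fin k => if h : q ∈ D' then (t' ⟨q, h⟩).code + 1 else 0) :
    ∃ e : D = D', t = fun q => t' ⟨q.1, e ▸ q.2⟩ := by
  have h' := fun q => congrFun (List.ofFn_injective h) q
  have e : D = D' := by
    ext q
    have := h' q
    by_cases h1 : q ∈ D <;> by_cases h2 : q ∈ D' <;> simp_all
  subst e
  refine ⟨rfl, funext fun q => ih _ _ ?_⟩
  have := h' q.1
  simpa using this

theorem Formula.code_injective {n : ℕ} : Function.Injective (Formula.code (n := n)) := by
  intro φ
  induction φ with
  | atom p =>
    intro ψ h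
    cases ψ <;> simp [code, Encodable.encode_prod_val] at h
    rw [Fin.val_injective h]
  | neg φ ih =>
    intro ψ h
    cases ψ <;> simp [code, Encodable.encode_prod_val] at h
    rw [ih h]
  | and φ ψ ih ih' =>
    intro ψ h
    cases ψ <;> simp [code, Encodable.encode_prod_val] at h
    rw [ih h.1, ih' h.2]
  | or φ ψ ih ih' =>
    intro ψ h
    cases ψ <;> simp [code, Encodable.encode_prod_val] at h
    rw [ih h.1, ih' h.2]
  | dia A D t φ iht ih =>
    intro ψ h
    cases ψ <;> simp [code, Encodable.encode_prod_val, -Encodable.encode_list_cons] at h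
    obtain ⟨rfl, rfl, hA, ht, hφ⟩ := h
    obtain ⟨rfl, rfl⟩ := code_tests (fun q ψ hq => iht q hq) ht
    rw [DPDA.code_injective hA, ih hφ]
  | box A D t φ iht ih =>
    intro ψ h
    cases ψ <;> simp [code, Encodable.encode_prod_val, -Encodable.encode_list_cons] at h
    obtain ⟨rfl, rfl, hA, ht, hφ⟩ := h
    obtain ⟨rfl, rfl⟩ := code_tests (fun q ψ hq => iht q hq) ht
    rw [DPDA.code_injective hA, ih hφ]

/-- The code of a visibly pushdown system. -/
def VPS.code {n : ℕ} {kind : Letter n → LetterKind} {k g : ℕ} (S : VPS kind k g) : ℕ :=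
  Encodable.encode (k, g,
    S.callTrans.map (fun τ => (τ.1.val, bits τ.2.1, τ.2.2.1.val, τ.2.2.2.val)),
    S.retTrans.map (fun τ => (τ.1.val, bits τ.2.1, τ.2.2.1.map Fin.val, τ.2.2.2.val)),
    S.locTrans.map (fun τ => (τ.1.val, bits τ.2.1, τ.2.2.val)))

theorem VPS.code_injective {n : ℕ} {kind : Letter n → LetterKind} {k g : ℕ} :
    Function.Injective (VPS.code (kind := kind) (k := k) (g := g)) := by
  rintro ⟨c, r, l, hc, hr, hl⟩ ⟨c', r', l', hc', hr', hl'⟩ h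
  have h := Encodable.encode_injective h
  simp only [Prod.mk.injEq] at h
  obtain ⟨-, -, h1, h2, h3⟩ := h
  have e1 : c = c' := List.map_injective_iff.2 (by
    rintro ⟨q, a, q', A⟩ ⟨p, b, p', B⟩ h
    simp only [Prod.mk.injEq] at h
    rw [Fin.val_injective h.1, bits_injective h.2.1, Fin.val_injective h.2.2.1,
      Fin.val_injective h.2.2.2]) h1
  have e2 : r = r' := List.map_injective_iff.2 (by
    rintro ⟨q, a, A, q'⟩ ⟨p, b, B, p'⟩ h
    simp only [Prod.mk.injEq] at h
    rw [Fin.val_injective h.1, bits_injective h.2.1,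
      Option.map_injective Fin.val_injective h.2.2.1, Fin.val_injective h.2.2.2]) h2
  have e3 : l = l' := List.map_injective_iff.2 (by
    rintro ⟨q, a, q'⟩ ⟨p, b, p'⟩ h
    simp only [Prod.mk.injEq] at h
    rw [Fin.val_injective h.1, bits_injective h.2.1, Fin.val_injective h.2.2]) h3
  subst e1 e2 e3
  rfl

/-- The code of an instance of the model checking problem. -/
def MCInstance.code {n : ℕ} {kind : Letter n → LetterKind} (M : MCInstance kind) : ℕ :=
  Encodable.encode (M.k, M.g, M.S.code, M.init.val, M.φ.code)

theorem MCInstance.code_injective {n : ℕ} {kind : Letter n → LetterKind} :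
    Function.Injective (MCInstance.code (kind := kind)) := by
  rintro ⟨k, g, S, q, φ⟩ ⟨k', g', S', q', φ'⟩ h
  have h := Encodable.encode_injective h
  simp only [Prod.mk.injEq] at h
  obtain ⟨rfl, rfl, h1, h2, h3⟩ := h
  rw [VPS.code_injective h1, Fin.val_injective h2, Formula.code_injective h3]

/-- The code of a visibly pushdown game. -/
def VPGame.code {n : ℕ} {kind : Letter n → LetterKind} (H : VPGame kind) : ℕ :=
  Encodable.encode (H.k, H.g, H.S.code, bits H.Q0, H.init.val, H.φ.code)

theorem VPGame.code_injective {n : ℕ} {kind : Letter n → LetterKind} :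
    Function.Injective (VPGame.code (kind := kind)) := by
  rintro ⟨k, g, S, Q, q, φ⟩ ⟨k', g', S', Q', q', φ'⟩ h
  have h := Encodable.encode_injective h
  simp only [Prod.mk.injEq] at h
  obtain ⟨rfl, rfl, h1, h0, h2, h3⟩ := h
  rw [VPS.code_injective h1, bits_injective h0, Fin.val_injective h2, Formula.code_injective h3]

/-- The code of a pushdown system. -/
def PDS.code {n k g : ℕ} (S : PDS n k g) : ℕ :=
  Encodable.encode (k, g, S.trans.map (fun τ => (τ.1.val, τ.2.1.map Fin.val, bits τ.2.2.1,
    τ.2.2.2.1.val, τ.2.2.2.2.map (Option.map Fin.val))))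

theorem PDS.code_injective {n k g : ℕ} :
    Function.Injective (PDS.code (n := n) (k := k) (g := g)) := by
  rintro ⟨Δ, hΔ⟩ ⟨Δ', hΔ'⟩ h
  have h := Encodable.encode_injective h
  simp only [Prod.mk.injEq] at h
  have e : Δ = Δ' := List.map_injective_iff.2 (by
    rintro ⟨q, A, a, q', β⟩ ⟨p, B, b, p', β'⟩ h
    simp only [Prod.mk.injEq] at h
    rw [Fin.val_injective h.1, Option.map_injective Fin.val_injective h.2.1,
      bits_injective h.2.2.1, Fin.val_injective h.2.2.2.1,
      List.map_injective_iff.2 (Option.map_injective Fin.val_injective) h.2.2.2.2]) h.2.2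
  subst e
  rfl

/-- The code of a pushdown game. -/
def PDGame.code {n : ℕ} (H : PDGame n) : ℕ :=
  Encodable.encode (H.k, H.g, H.S.code, bits H.Q0, H.init.val, H.φ.code)

theorem PDGame.code_injective {n : ℕ} : Function.Injective (PDGame.code (n := n)) := by
  rintro ⟨k, g, S, Q, q, φ⟩ ⟨k', g', S', Q', q', φ'⟩ h
  have h := Encodable.encode_injective h
  simp only [Prod.mk.injEq] at h
  obtain ⟨rfl, rfl, h1, h0, h2, h3⟩ := h
  rw [PDS.code_injective h1, bits_injective h0, Fin.val_injective h2, Formula.code_injective h3]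

/-! ## Decidability -/

/-- The decision problem with instances `I`, presented by the codes `code x`, and with
yes-instances `yes` is decidable: some computable function gives the correct answer on the codes of
all instances (and any answer on numbers that code no instance). -/
def DecidableProblem {I : Type} (code : I → ℕ) (yes : I → Prop) : Prop :=
  ∃ f : ℕ → Bool, Computable f ∧ ∀ x : I, f (code x) = true ↔ yes x

end DPLDL

namespace DPLDL

/-! Non-halting of Turing machines is encoded into satisfiability. Both tape halves are numbers in
base `B`, extended by a last digit below `K` that records side, state and head symbol. A run becomes
a sequence left, right, left, right, ... of numbers in which every term is `p * (a / M) + s`. Here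
`a` is the term two places earlier, `M = K * B`, and `p`, `s` depend only on the residues modulo `M`
of the two preceding terms (`recRel_left_iff`, `recRel_right_iff`). Interleaving the halves lets
each term depend on just one earlier term in full, which is what a single stack can handle. For a
suitable fixed rule it is therefore undecidable whether given initial values extend to an infinite
solution (`exists_undecidable_recurrence`).

A solution `a` is written at one proposition as blocks of `a 0`, `a 1`, ... ones, each ended by a
zero. A deterministic automaton checks three consecutive blocks in one pass: it stores the first
quotient on the stack and the residues in its control, and matches the third block against the stack
(`recReaches_done_iff`). A formula fixes the first two blocks and requires, by a box over all block
starts, a diamond of this automaton. Each triple is checked with a fresh stack, and the overlap of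
the triples chains the local checks into a full solution (`exists_word_iff_exists_sequence`,
`models_solutionFormula`). The negated formula is valid exactly when there is no solution.

The other three problems contain validity: a one-state system produces all words, and in the games
every state belongs to Player 1 (`universalVPS_holds_iff`, `playerZeroWins_configGame_iff`). -/

/-! ### From partial recursive functions to Turing machines. -/

open Turing in
/-- Every partial recursive function has the halting domain of a Turing machine with a finite
alphabet and finitely many relevant states, on the reversed binary presentation of the input. -/
theorem exists_TM0_of_partrec {f : ℕ →. ℕ} (hf : Partrec f) :
    ∃ (Γ Λ : Type) (_ : Inhabited Γ) (_ : Finite Γ) (_ : Inhabited Λ) (M : TM0.Machine Γ Λ)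
      (S : Finset Λ) (_ : TM0.Supports M (S : Set Λ)) (g : PartrecToTM2.Γ' → Γ) (h : Γ), ∀ x,
      (StateTransition.eval (TM0.step M)
        (TM0.init (h :: (PartrecToTM2.trNat x).reverse.map g))).Dom ↔ (f x).Dom := by
  classical
  have hK : Finite PartrecToTM2.K' :=
    Finite.of_surjective ![.main, .rev, .aux, .stack] fun k => by
      cases k
      exacts [⟨0, rfl⟩, ⟨1, rfl⟩, ⟨2, rfl⟩, ⟨3, rfl⟩]
  have hG : Finite (TM2to1.Γ' PartrecToTM2.K' fun _ => PartrecToTM2.Γ') :=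
    inferInstanceAs (Finite (Bool × (PartrecToTM2.K' → Option PartrecToTM2.Γ')))
  obtain ⟨c, hc⟩ := ToPartrec.Code.exists_code (Nat.Partrec'.part_iff₁.2 hf)
  -- A machine starts in its default label, so the default is chosen as the entry point of the
  -- program `c`.
  let _ : Inhabited PartrecToTM2.Λ' := ⟨PartrecToTM2.trNormal c PartrecToTM2.Cont'.halt⟩
  have hs : TM2.Supports PartrecToTM2.tr (PartrecToTM2.codeSupp c PartrecToTM2.Cont'.halt) :=
    PartrecToTM2.tr_supports c _
  have hs' := TM1to0.tr_supports _ (TM2to1.tr_supports PartrecToTM2.tr hs)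
  refine ⟨_, _, inferInstance, hG, inferInstance, _, _, hs',
    -- A tape cell holds a bottom flag and one symbol per stack. The reversed input list begins with
    -- its terminator `cons`, so the flagged first cell `h` is the same for all inputs.
    fun a => (false, Function.update (fun _ => none) PartrecToTM2.K'.main (some a)),
    (true, Function.update (fun _ => none) PartrecToTM2.K'.main (some PartrecToTM2.Γ'.cons)),
    fun x => ?_⟩
  have h1 := TM2to1.tr_eval_dom PartrecToTM2.tr PartrecToTM2.K'.main (PartrecToTM2.trList [x])
  rw [← TM1to0.tr_eval] at h1
  have h2 : (TM2.init PartrecToTM2.K'.main (PartrecToTM2.trList [x]) :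
      TM2.Cfg (fun _ : PartrecToTM2.K' => PartrecToTM2.Γ') PartrecToTM2.Λ' (Option PartrecToTM2.Γ'))
      = PartrecToTM2.init c [x] := by
    unfold TM2.init PartrecToTM2.init
    congr 1
    funext k
    cases k <;> rfl
  have h3 : (TM2.eval PartrecToTM2.tr PartrecToTM2.K'.main (PartrecToTM2.trList [x])).Dom ↔
      (f x).Dom := by
    unfold TM2.eval
    rw [h2, PartrecToTM2.tr_eval]
    have := hc (x ::ᵥ List.Vector.nil)
    simp only [List.Vector.cons_val, List.Vector.head_cons] at this
    change (Part.map _ (Part.map _ (c.eval [x]))).Dom ↔ _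
    change c.eval [x] = _ at this
    rw [this]
    rfl
  rw [← h3, ← h1]
  unfold TM0.eval
  rw [Part.map_Dom]
  simp only [TM2to1.trInit, PartrecToTM2.trList, List.reverse_append, List.reverse_cons,
    List.reverse_nil, List.nil_append, List.singleton_append]
  rfl

open Turing StateTransition

/-! ## Turing machines with the tape halves as numbers -/

section Digits

variable {Γ : Type} [Inhabited Γ] {B : ℕ} {e : Γ → ℕ}

/-- The base-`B` digits of `N` are the codes of the symbols of `l`. -/
def IsDigits (B : ℕ) (e : Γ → ℕ) (N : ℕ) (l : ListBlank Γ) : Prop :=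
  ∀ i, N / B ^ i % B = e (l.nth i)

theorem IsDigits.head {N : ℕ} {l : ListBlank Γ} (h : IsDigits B e N l) : N % B = e l.head := by
  simpa using h 0

theorem IsDigits.tail {N : ℕ} {l : ListBlank Γ} (h : IsDigits B e N l) :
    IsDigits B e (N / B) l.tail := by
  intro i
  have := h (i + 1)
  rwa [ListBlank.nth_succ, pow_succ', ← Nat.div_div_eq_div_mul] at this

theorem IsDigits.cons {N : ℕ} {l : ListBlank Γ} (h : IsDigits B e N l) {a : Γ} (ha : e a < B) :
    IsDigits B e (B * N + e a) (l.cons a) := by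
  have hB : 0 < B := by omega
  intro i
  cases i with
  | zero => simp [Nat.mod_eq_of_lt ha]
  | succ i =>
    rw [ListBlank.nth_succ, pow_succ', ← Nat.div_div_eq_div_mul, ListBlank.tail_cons,
      Nat.mul_add_div hB, Nat.div_eq_of_lt ha, add_zero, h i]

/-- Blanks have digit `0`, so the infinite blank end of a tape adds nothing and a finite number
presents it. -/
theorem IsDigits.mk (he : ∀ a, e a < B) (h0 : e default = 0) (l : List Γ) :
    IsDigits B e ((l.map e).foldr (fun d s => B * s + d) 0) (ListBlank.mk l) := by
  induction l with
  | nil => intro i; simp [ListBlank.nth_mk, h0]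
  | cons a l ih =>
    rw [← ListBlank.cons_mk]
    exact ih.cons (he a)

end Digits

/-- A configuration of a Turing machine with both halves of the tape presented by numbers. -/
structure NumCfg (Q Γ : Type) where
  state : Q
  head : Γ
  left : ℕ
  right : ℕ

section Simulation

variable {Q Γ : Type}

/-- The step of a Turing machine on numerical configurations. -/
def numStep (δ : Q → Γ → Option (Q × TM0.Stmt Γ)) (B : ℕ) (e : Γ → ℕ) (dec : ℕ → Γ)
    (c : NumCfg Q Γ) : Option (NumCfg Q Γ) :=
  match δ c.state c.head with
  | none => none
  | some (q, .write a) => some ⟨q, a, c.left, c.right⟩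
  | some (q, .move .left) =>
    some ⟨q, dec (c.left % B), c.left / B, B * c.right + e c.head⟩
  | some (q, .move .right) =>
    some ⟨q, dec (c.right % B), B * c.left + e c.head, c.right / B⟩

variable {Λ : Type} [Inhabited Γ] [Inhabited Λ]

/-- The restriction of a machine to the states in `S`. -/
noncomputable def restrictMachine (M : TM0.Machine Γ Λ) (S : Finset Λ) (q : {q // q ∈ S}) (a : Γ) :
    Option ({q // q ∈ S} × TM0.Stmt Γ) :=
  open Classical in (M q a).bind fun r => if h : r.1 ∈ S then some (⟨r.1, h⟩, r.2) else none

/-- A head move takes the last digit off one half by division with remainder and appends the old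
head symbol to the other half as a new last digit. As `S` is closed under the moves of `M`, the
restriction to `S` discards none that is needed. -/
theorem numStep_respects (M : TM0.Machine Γ Λ) {S : Finset Λ} (hS : TM0.Supports M (S : Set Λ))
    {B : ℕ} {e : Γ → ℕ} {dec : ℕ → Γ} (he : ∀ a, e a < B) (hdec : ∀ a, dec (e a) = a) :
    Respects (TM0.step M) (numStep (restrictMachine M S) B e dec) fun c d =>
      c.q = d.state ∧ c.Tape.head = d.head ∧ IsDigits B e d.left c.Tape.left ∧
        IsDigits B e d.right c.Tape.right := by
  rintro ⟨q, h, l, r⟩ ⟨⟨q', hq'⟩, h', L, R⟩ ⟨h1, h2, h3, h4⟩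
  simp only at h1 h2 h3 h4
  subst h1 h2
  cases hM : M q h with
  | none => simp [TM0.step, numStep, restrictMachine, hM]
  | some p =>
    obtain ⟨p, s⟩ := p
    have hp : p ∈ S := by
      obtain ⟨-, h2⟩ := hS
      exact h2 (q := q) (a := h) (s := s) (by rw [hM]; rfl) hq'
    have hr : restrictMachine M S ⟨q, hq'⟩ h = some (⟨p, hp⟩, s) := by
      simp [restrictMachine, hM, hp]
    simp only [TM0.step, hM, Option.map_some]
    rcases s with d | a
    · cases d
      · refine ⟨_, ?_, Relation.TransGen.single (by simp only [numStep, hr]; rfl)⟩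
        refine ⟨rfl, ?_, h3.tail, h4.cons (he h)⟩
        simp only [h3.head, hdec]
        rfl
      · refine ⟨_, ?_, Relation.TransGen.single (by simp only [numStep, hr]; rfl)⟩
        refine ⟨rfl, ?_, h3.cons (he h), h4.tail⟩
        simp only [h4.head, hdec]
        rfl
    · exact ⟨_, ⟨rfl, rfl, h3, h4⟩, Relation.TransGen.single (by simp only [numStep, hr]; rfl)⟩

end Simulation

theorem eval_dom_iff_no_infinite_run {σ : Type} (f : σ → Option σ) (c : σ) :
    (eval f c).Dom ↔ ¬ ∃ s : ℕ → σ, s 0 = c ∧ ∀ t, f (s t) = some (s (t + 1)) := by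
  constructor
  · intro h
    rintro ⟨s, h0, hs⟩
    obtain ⟨b, hb⟩ := Part.dom_iff_mem.1 h
    obtain ⟨hr, hn⟩ := mem_eval.1 hb
    have : ∃ t, b = s t := by
      clear hb hn h
      induction hr with
      | refl => exact ⟨0, h0.symm⟩
      | tail _ h ih =>
        obtain ⟨t, rfl⟩ := ih
        rw [Option.mem_def, hs, Option.some_inj] at h
        exact ⟨t + 1, h.symm⟩
    obtain ⟨t, rfl⟩ := this
    rw [hs] at hn
    exact Option.some_ne_none _ hn
  · intro h
    by_contra hd
    -- The default in `getD` is never used: without halting, every reachable configuration has a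
    -- successor.
    refine h ⟨fun t => (fun c => (f c).getD c)^[t] c, rfl, fun t => ?_⟩
    have hr : ∀ t, Reaches f c ((fun c => (f c).getD c)^[t] c) ∧
        ∃ d, f ((fun c => (f c).getD c)^[t] c) = some d := by
      have key : ∀ b, Reaches f c b → ∃ d, f b = some d := by
        intro b hb
        by_contra! hn
        exact hd (Part.dom_iff_mem.2 ⟨b, mem_eval.2 ⟨hb, Option.eq_none_iff_forall_ne_some.2 hn⟩⟩)
      intro t
      suffices Reaches f c ((fun c => (f c).getD c)^[t] c) from ⟨this, key _ this⟩
      induction t with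
      | zero => exact .refl
      | succ t ih =>
        obtain ⟨d, hd⟩ := key _ ih
        refine ih.tail ?_
        rw [Function.iterate_succ_apply', hd]
        rfl
    obtain ⟨d, hd⟩ := (hr t).2
    change f ((fun c => (f c).getD c)^[t] c) = some ((fun c => (f c).getD c)^[t + 1] c)
    rw [Function.iterate_succ_apply', hd]
    rfl

/-! ## Second-order recurrences -/

/-- `c` is the value `p * (a / M) + s`, where `(p, s)` is given by the residues of `a` and `b`
modulo `M`. -/
def RecRel (M : ℕ) (F : ℕ → ℕ → Option (ℕ × ℕ)) (a b c : ℕ) : Prop :=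
  ∃ p s, F (a % M) (b % M) = some (p, s) ∧ c = p * (a / M) + s

section Recurrence

variable {Q Γ : Type}

/-- The coding of a half of the tape together with state, head symbol and side. -/
def encHalf (K : ℕ) (code : Bool × Q × Γ → ℕ) (side : Bool) (c : NumCfg Q Γ) : ℕ :=
  K * (if side then c.right else c.left) + code (side, c.state, c.head)

/-- The coefficients of the recurrence that alternately updates the left and the right half. -/
def machineRule (δ : Q → Γ → Option (Q × TM0.Stmt Γ)) (B : ℕ) (e : Γ → ℕ) (dec : ℕ → Γ) (K : ℕ)
    (code : Bool × Q × Γ → ℕ) (decode : ℕ → Bool × Q × Γ) (u v : ℕ) : Option (ℕ × ℕ) :=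
  match decode (u % K) with
  | (false, q, h) =>
    match δ q h with
    | none => none
    | some (q', .write a) => some (K * B, K * (u / K) + code (false, q', a))
    | some (q', .move .left) => some (K, code (false, q', dec (u / K)))
    | some (q', .move .right) =>
      some (K * B * B, K * (B * (u / K) + e h) + code (false, q', dec (v / K)))
  | (true, q, h) =>
    match δ q h with
    | none => none
    | some (_, .write _) => some (K * B, K * (u / K) + code (true, (decode (v % K)).2))
    | some (_, .move .left) =>
      some (K * B * B, K * (B * (u / K) + e h) + code (true, (decode (v % K)).2))
    | some (_, .move .right) => some (K, code (true, (decode (v % K)).2))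

variable {δ : Q → Γ → Option (Q × TM0.Stmt Γ)} {B : ℕ} {e : Γ → ℕ} {dec : ℕ → Γ} {K : ℕ}
  {code : Bool × Q × Γ → ℕ} {decode : ℕ → Bool × Q × Γ}

theorem machineRule_pos (hB : 0 < B) (hK : 0 < K) {u v p s : ℕ}
    (h : machineRule δ B e dec K code decode u v = some (p, s)) : 0 < p := by
  have h1 : 0 < K * B := by positivity
  have h2 : 0 < K * B * B := by positivity
  unfold machineRule at h
  split at h <;> split at h <;> simp at h <;> omega

theorem encHalf_mod_mod (hK : ∀ c, code c < K) (side : Bool) (c : NumCfg Q Γ) :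
    encHalf K code side c % (K * B) % K = code (side, c.state, c.head) := by
  rw [Nat.mod_mul_right_mod, encHalf, Nat.mul_add_mod, Nat.mod_eq_of_lt (hK _)]

theorem encHalf_mod_div (hK : ∀ c, code c < K) (side : Bool) (c : NumCfg Q Γ) :
    encHalf K code side c % (K * B) / K = (if side then c.right else c.left) % B := by
  have : 0 < K := (Nat.zero_le _).trans_lt (hK (side, c.state, c.head))
  rw [Nat.mod_mul_right_div_self, encHalf, Nat.mul_add_div this, Nat.div_eq_of_lt (hK _), add_zero]

theorem encHalf_div (hK : ∀ c, code c < K) (side : Bool) (c : NumCfg Q Γ) :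
    encHalf K code side c / (K * B) = (if side then c.right else c.left) / B := by
  have : 0 < K := (Nat.zero_le _).trans_lt (hK (side, c.state, c.head))
  rw [← Nat.div_div_eq_div_mul, encHalf, Nat.mul_add_div this, Nat.div_eq_of_lt (hK _), add_zero]

/-- The residues modulo `K * B` reveal the state, the head symbol and the last digit of each half.
With these known, the next left half is affine in the quotient of the old one by `B`, whatever the
move. -/
theorem recRel_left_iff (hK : ∀ c, code c < K) (hcode : ∀ c, decode (code c) = c)
    (c : NumCfg Q Γ) (z : ℕ) :
    RecRel (K * B) (machineRule δ B e dec K code decode) (encHalf K code false c)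
      (encHalf K code true c) z ↔
      ∃ c', numStep δ B e dec c = some c' ∧ z = encHalf K code false c' := by
  obtain ⟨q, h, l, r⟩ := c
  have hl := Nat.div_add_mod l B
  simp only [RecRel, machineRule, encHalf_mod_mod hK, encHalf_mod_div hK, encHalf_div hK, hcode,
    numStep, Bool.false_eq_true, if_false, if_true]
  generalize l / B = x at *
  generalize l % B = y at *
  subst hl
  rcases δ q h with _ | ⟨q', (_ | _) | a⟩
  · simp
  all_goals
    simp only [Bool.false_eq_true, if_false, Option.some.injEq, Prod.mk.injEq,
      exists_eq_left', exists_and_left, and_assoc, encHalf]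
    try exact Iff.of_eq (by congr 1; ring)

/-- Here the second argument is the left half after the step. Its residue supplies the new state and
head symbol, while the old right half still carries the old ones, which determine the move. -/
theorem recRel_right_iff (hK : ∀ c, code c < K) (hcode : ∀ c, decode (code c) = c)
    {c c' : NumCfg Q Γ} (hc : numStep δ B e dec c = some c') (z : ℕ) :
    RecRel (K * B) (machineRule δ B e dec K code decode) (encHalf K code true c)
      (encHalf K code false c') z ↔ z = encHalf K code true c' := by
  obtain ⟨q, h, l, r⟩ := c
  obtain ⟨q₁, h₁, l₁, r₁⟩ := c'
  have hl := Nat.div_add_mod r B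
  simp only [RecRel, machineRule, encHalf_mod_mod hK, encHalf_mod_div hK, encHalf_div hK, hcode,
    numStep, if_true] at hc ⊢
  generalize r / B = x at *
  generalize r % B = y at *
  subst hl
  rcases hδ : δ q h with _ | ⟨q', (_ | _) | a⟩ <;>
    simp only [hδ, Option.some.injEq, reduceCtorEq, NumCfg.mk.injEq] at hc
  all_goals
    obtain ⟨rfl, rfl, rfl, rfl⟩ := hc
    simp only [if_true, Option.some.injEq, Prod.mk.injEq,
      exists_eq_left', exists_and_left, and_assoc, encHalf]
    try exact Iff.of_eq (by congr 1; ring)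

theorem recurrence_iff_infinite_run (hK : ∀ c, code c < K) (hcode : ∀ c, decode (code c) = c)
    (c : NumCfg Q Γ) :
    (∃ a : ℕ → ℕ, a 0 = encHalf K code false c ∧ a 1 = encHalf K code true c ∧
      ∀ j, RecRel (K * B) (machineRule δ B e dec K code decode) (a j) (a (j + 1)) (a (j + 2))) ↔
    ∃ s : ℕ → NumCfg Q Γ, s 0 = c ∧ ∀ t, numStep δ B e dec (s t) = some (s (t + 1)) := by
  constructor
  · rintro ⟨a, h0, h1, ha⟩
    by_contra hd
    obtain ⟨b, hb⟩ := Part.dom_iff_mem.1 ((eval_dom_iff_no_infinite_run _ _).2 hd)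
    obtain ⟨hr, hn⟩ := mem_eval.1 hb
    -- A solution must follow the run, two terms per step; at a halting configuration the rule has
    -- no value, a contradiction.
    have step : ∀ t d, a (2 * t) = encHalf K code false d → a (2 * t + 1) = encHalf K code true d →
        ∃ d', numStep δ B e dec d = some d' ∧ a (2 * (t + 1)) = encHalf K code false d' ∧
          a (2 * (t + 1) + 1) = encHalf K code true d' := by
      intro t d hl hr
      have h2 := ha (2 * t)
      rw [hl, hr, recRel_left_iff hK hcode] at h2
      obtain ⟨d', hd', h2⟩ := h2
      have h3 := ha (2 * t + 1)
      rw [hr, h2, recRel_right_iff hK hcode hd'] at h3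
      exact ⟨d', hd', h2, h3⟩
    have : ∃ t, a (2 * t) = encHalf K code false b ∧ a (2 * t + 1) = encHalf K code true b := by
      clear hn hb
      induction hr with
      | refl => exact ⟨0, h0, h1⟩
      | tail _ h ih =>
        obtain ⟨t, hl, hr⟩ := ih
        obtain ⟨d', hd', h'⟩ := step t _ hl hr
        rw [Option.mem_def, hd', Option.some_inj] at h
        exact ⟨t + 1, h ▸ h'⟩
    obtain ⟨t, hl, hr⟩ := this
    obtain ⟨d', hd', -⟩ := step t _ hl hr
    rw [hn] at hd'
    cases hd'
  · rintro ⟨s, rfl, hs⟩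
    refine ⟨fun j => encHalf K code (j % 2 = 1) (s (j / 2)), rfl, rfl, fun j => ?_⟩
    obtain ⟨t, rfl | rfl⟩ := Nat.even_or_odd' j
    · have e1 : (2 * t + 1) / 2 = t := by omega
      have e2 : (2 * t + 2) / 2 = t + 1 := by omega
      simp only [e1, e2, Nat.mul_add_mod, Nat.mul_mod_right, Nat.mul_div_cancel_left, Nat.add_mod_right,
        Nat.zero_lt_two]
      exact (recRel_left_iff hK hcode _ _).2 ⟨_, hs t, rfl⟩
    · have e1 : (2 * t + 1) / 2 = t := by omega
      have e2 : (2 * t + 1 + 1) / 2 = t + 1 := by omega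
      have e3 : (2 * t + 1 + 2) / 2 = t + 1 := by omega
      have e4 : (2 * t + 1 + 1) % 2 = 0 := by omega
      have e5 : (2 * t + 1) % 2 = 1 := by omega
      have e6 : (2 * t + 1 + 2) % 2 = 1 := by omega
      simp only [e1, e2, e3, e4, e5, e6]
      exact (recRel_right_iff hK hcode (hs t) _).2 rfl

end Recurrence

/-! ## Binary presentations -/

open PartrecToTM2 in
theorem trNat_of_pos {x : ℕ} (hx : x ≠ 0) :
    trNat x = (if x % 2 = 1 then Γ'.bit1 else Γ'.bit0) :: trNat (x / 2) := by
  have h1 : ∀ m : Num, trNum m.bit1 = Γ'.bit1 :: trNum m := by rintro (_ | m) <;> rfl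
  have h0 : ∀ m : Num, m ≠ 0 → trNum m.bit0 = Γ'.bit0 :: trNum m := by
    rintro (_ | m) hm
    · exact absurd rfl hm
    · rfl
  unfold trNat
  rcases Nat.mod_two_eq_zero_or_one x with h | h
  · have e : x = Nat.bit false (x / 2) := by simp [Nat.bit]; omega
    have e0 : x / 2 ≠ 0 := by omega
    conv_lhs => rw [e, ← Num.ofNat'_eq, Num.ofNat'_bit]
    simp only [cond_false, h, Num.ofNat'_eq]
    rw [h0]
    · simp
    · exact_mod_cast e0
  · have e : x = Nat.bit true (x / 2) := by simp [Nat.bit]; omega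
    conv_lhs => rw [e, ← Num.ofNat'_eq, Num.ofNat'_bit]
    simp only [cond_true, h, Num.ofNat'_eq, h1, if_true]

theorem primrec_trNat_map (d : PartrecToTM2.Γ' → ℕ) :
    Primrec fun x => (PartrecToTM2.trNat x).map d := by
  have : Primrec₂ fun (_ : Unit) x => (PartrecToTM2.trNat x).map d := by
    -- Course-of-values recursion: `L` lists the values below `x`, so `L.length` is `x`, and the
    -- entry at `x / 2` gives the remaining bits.
    refine Primrec.nat_strong_rec _ (g := fun _ L => if L.length = 0 then some [] else
      (L[L.length / 2]?).map fun l =>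
        (if L.length % 2 = 1 then d .bit1 else d .bit0) :: l) ?_ ?_
    · have hl : Primrec fun p : Unit × List (List ℕ) => p.2.length :=
        Primrec.list_length.comp Primrec.snd
      refine Primrec.ite (Primrec.eq.comp hl (Primrec.const 0)) (Primrec.const _) ?_
      refine Primrec.option_map (Primrec.list_getElem?.comp Primrec.snd
        (Primrec.nat_div.comp hl (Primrec.const 2))) ?_
      exact Primrec.list_cons.comp (Primrec.ite (Primrec.eq.comp (Primrec.nat_mod.comp
        (hl.comp Primrec.fst) (Primrec.const 2)) (Primrec.const 1)) (Primrec.const _)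
        (Primrec.const _)) Primrec.snd
    · intro _ x
      simp only [List.length_map, List.length_range]
      by_cases h : x = 0
      · simp [h]
      · rw [if_neg h, trNat_of_pos h, List.getElem?_map, List.getElem?_range (by omega)]
        split_ifs <;> rfl
  exact this.comp (Primrec.const ()) Primrec.id

/-! ## An undecidable recurrence problem -/

/-- The machine is fixed and halts on `x` exactly when the program numbered `x` halts on `0`. Hence
modulus and rule are fixed, and `x` enters only through the initial right half. -/
theorem exists_undecidable_recurrence :
    ∃ (M : ℕ) (F : ℕ → ℕ → Option (ℕ × ℕ)) (b : ℕ) (N : ℕ → ℕ), 0 < M ∧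
      (∀ u v p s, F u v = some (p, s) → 0 < p) ∧ Primrec N ∧
      ¬ ComputablePred fun x => ∃ a : ℕ → ℕ, a 0 = b ∧ a 1 = N x ∧
        ∀ j, RecRel M F (a j) (a (j + 1)) (a (j + 2)) := by
  classical
  have hf : Partrec fun x : ℕ => Nat.Partrec.Code.eval (Denumerable.ofNat Nat.Partrec.Code x) 0 :=
    Nat.Partrec.Code.eval_part.comp (Computable.ofNat _) (Computable.const 0)
  obtain ⟨Γ, Λ, _, _, _, T, S, hS, g, h, hT⟩ := exists_TM0_of_partrec hf
  have := Fintype.ofFinite Γ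
  have hdef : (default : Λ) ∈ S := hS.1
  -- The blank gets digit `0`; all other symbols are shifted by one to stay clear of it.
  let e : Γ → ℕ := fun a => if a = default then 0 else Fintype.equivFin Γ a + 1
  have he : ∀ a, e a < Fintype.card Γ + 1 := by
    intro a
    have := (Fintype.equivFin Γ a).2
    simp only [e]
    split_ifs <;> omega
  have hei : Function.Injective e := by
    intro a a' h
    simp only [e] at h
    split_ifs at h with h1 h2
    · rw [h1, h2]
    · exact (Fintype.equivFin Γ).injective (Fin.val_injective (by omega))
  let C := Bool × {q // q ∈ S} × Γ
  have : Nonempty C := ⟨false, ⟨default, hdef⟩, default⟩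
  let code : C → ℕ := fun c => Fintype.equivFin C c
  have hcode : Function.Injective code := Fin.val_injective.comp (Fintype.equivFin C).injective
  have hK : ∀ c, code c < Fintype.card C := fun c => (Fintype.equivFin C c).2
  have hr := numStep_respects T hS he (Function.leftInverse_invFun hei)
  let R : ℕ → ℕ := fun x => (((PartrecToTM2.trNat x).reverse.map g).map e).foldr
    (fun d s => (Fintype.card Γ + 1) * s + d) 0
  -- The left half is empty and the head symbol constant, so the first term of the sequence does not
  -- depend on `x`.
  let cfg : ℕ → NumCfg {q // q ∈ S} Γ := fun x => ⟨⟨default, hdef⟩, h, 0, R x⟩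
  refine ⟨Fintype.card C * (Fintype.card Γ + 1), machineRule (restrictMachine T S)
    (Fintype.card Γ + 1) e (Function.invFun e) (Fintype.card C) code (Function.invFun code),
    code (false, ⟨default, hdef⟩, h), fun x => encHalf (Fintype.card C) code true (cfg x),
    Nat.mul_pos Fintype.card_pos (Nat.succ_pos _),
    fun u v p s => machineRule_pos (Nat.succ_pos _) Fintype.card_pos, ?_, ?_⟩
  · have h1 : Primrec R := by
      have h2 : Primrec fun x => ((PartrecToTM2.trNat x).map fun a => e (g a)).reverse :=
        Primrec.list_reverse.comp (primrec_trNat_map _)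
      refine (Primrec.list_foldr (h := fun _ p => (Fintype.card Γ + 1) * p.2 + p.1) h2
        (Primrec.const 0) ?_).of_eq fun x => ?_
      · exact Primrec.nat_add.comp (Primrec.nat_mul.comp (Primrec.const _)
          (Primrec.snd.comp Primrec.snd)) (Primrec.fst.comp Primrec.snd)
      · simp only [R, List.map_reverse, List.map_map]
        rfl
    exact Primrec.nat_add.comp (Primrec.nat_mul.comp (Primrec.const _) h1)
      (Primrec.const (code (true, ⟨default, hdef⟩, h)))
  · intro hc
    refine ComputablePred.halting_problem 0 ?_
    have key : ∀ x, (∃ a : ℕ → ℕ, a 0 = code (false, ⟨default, hdef⟩, h) ∧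
        a 1 = encHalf (Fintype.card C) code true (cfg x) ∧
        ∀ j, RecRel (Fintype.card C * (Fintype.card Γ + 1)) (machineRule (restrictMachine T S)
          (Fintype.card Γ + 1) e (Function.invFun e) (Fintype.card C) code (Function.invFun code))
          (a j) (a (j + 1)) (a (j + 2))) ↔
        ¬ (Nat.Partrec.Code.eval (Denumerable.ofNat Nat.Partrec.Code x) 0).Dom := by
      intro x
      rw [← hT x, ← tr_eval_dom hr (a₂ := cfg x), eval_dom_iff_no_infinite_run, not_not,
        ← recurrence_iff_infinite_run hK (Function.leftInverse_invFun hcode)]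
      · simp [encHalf, cfg]
      · refine ⟨rfl, rfl, ?_, ?_⟩
        · exact IsDigits.mk he (if_pos rfl) []
        · exact IsDigits.mk he (if_pos rfl) _
    obtain ⟨_, hc⟩ := hc
    have h3 : Computable fun c : Nat.Partrec.Code => decide (c.eval 0).Dom := by
      refine (Primrec.not.to_comp.comp (hc.comp Computable.encode)).of_eq fun c => ?_
      have := key (Encodable.encode c)
      rw [Denumerable.ofNat_encode] at this
      by_cases hd : (c.eval 0).Dom <;> simp_all
    exact ⟨_, h3⟩

open Relation

/-! ## Real-time automata that read one proposition -/

section RealTime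

variable {Q : Type}

/-- The move of a pushdown automaton without spontaneous moves on a sequence of bits, with the stack
alphabet `Fin 2`. A configuration consists of position, state and stack. -/
def rtStep (δ : Q → Fin 2 → Bool → Option (Q × List (Fin 2))) (w : ℕ → Bool) :
    ℕ × Q × List (Fin 2) → Option (ℕ × Q × List (Fin 2))
  | (_, _, []) => none
  | (m, q, X :: rest) => (δ q X (w m)).map fun r => (m + 1, r.1, r.2 ++ rest)

/-- Reachability of configurations. -/
abbrev RtReaches (δ : Q → Fin 2 → Bool → Option (Q × List (Fin 2))) (w : ℕ → Bool) :
    ℕ × Q × List (Fin 2) → ℕ × Q × List (Fin 2) → Prop :=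
  ReflTransGen fun c c' => rtStep δ w c = some c'

theorem rtStep_eq_some {δ : Q → Fin 2 → Bool → Option (Q × List (Fin 2))} {w : ℕ → Bool} {m : ℕ}
    {q : Q} {st : List (Fin 2)} {c : ℕ × Q × List (Fin 2)} :
    rtStep δ w (m, q, st) = some c ↔
      ∃ X rest r, st = X :: rest ∧ δ q X (w m) = some r ∧ c = (m + 1, r.1, r.2 ++ rest) := by
  cases st with
  | nil => simp [rtStep]
  | cons X rest => simp [rtStep, eq_comm]

theorem RtReaches.pos_le {δ : Q → Fin 2 → Bool → Option (Q × List (Fin 2))} {w : ℕ → Bool}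
    {c c' : ℕ × Q × List (Fin 2)} (h : RtReaches δ w c c') : c.1 ≤ c'.1 := by
  induction h with
  | refl => exact le_rfl
  | @tail d d' _ h ih =>
    obtain ⟨X, rest, r, -, -, rfl⟩ := rtStep_eq_some.1 h
    exact ih.trans (Nat.le_succ _)

variable {n : ℕ}

/-- The bits of a word at the proposition `p`. -/
def bitsAt (p : Fin n) (α : Word n) (m : ℕ) : Bool := decide (p ∈ α m)

/-- The deterministic pushdown automaton with states in the finite set `S` and the given move
function, which only reads the proposition `p`. -/
noncomputable def DPDA.ofStep (p : Fin n) (S : Finset Q)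
    (δ : Q → Fin 2 → Bool → Option (Q × List (Fin 2))) (q₀ : {q // q ∈ S}) (f : Set Q) :
    DPDA n S.card 2 :=
  open Classical in
  { trans := (Finset.univ : Finset ({q // q ∈ S} × Fin 2 × Letter n)).toList.filterMap fun x =>
      (δ x.1 x.2.1 (decide (p ∈ x.2.2))).bind fun r =>
        if h : r.1 ∈ S then some ⟨S.equivFin x.1, some x.2.2, x.2.1, S.equivFin ⟨r.1, h⟩, r.2⟩
        else none
    init := S.equivFin q₀
    bottom := 0
    final := Finset.univ.filter fun i => (S.equivFin.symm i : Q) ∈ f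
    det := by
      simp only [List.mem_filterMap, Finset.mem_toList, Finset.mem_univ, true_and,
        Option.bind_eq_some_iff, Option.dite_none_right_eq_some]
      rintro _ ⟨⟨q, X, a⟩, r, hr, h, h1⟩ _ ⟨⟨q', X', a'⟩, r', hr', h', h1'⟩
      rw [Option.some_inj] at h1 h1'
      subst h1 h1'
      simp only [EmbeddingLike.apply_eq_iff_eq, Option.some.injEq, reduceCtorEq, or_false]
      rintro rfl rfl rfl
      rw [hr, Option.some_inj] at hr'
      subst hr'
      rfl }

theorem DPDA.ofStep_step_iff (p : Fin n) (S : Finset Q)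
    (δ : Q → Fin 2 → Bool → Option (Q × List (Fin 2))) (q₀ : {q // q ∈ S}) (f : Set Q) (α : Word n)
    (m : ℕ) (q : {q // q ∈ S}) (st : List (Fin 2)) (d : DPDA.Conf S.card 2) :
    (DPDA.ofStep p S δ q₀ f).Step α ⟨m, S.equivFin q, st⟩ d ↔
      ∃ q' : {q // q ∈ S}, ∃ st', rtStep δ (bitsAt p α) (m, q.1, st) = some (m + 1, q'.1, st') ∧
        d = ⟨m + 1, S.equivFin q', st'⟩ := by
  classical
  simp only [DPDA.Step, DPDA.ofStep, List.mem_filterMap, Finset.mem_toList, Finset.mem_univ,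
    true_and, Option.bind_eq_some_iff, Option.dite_none_right_eq_some, rtStep_eq_some, bitsAt]
  constructor
  · rintro ⟨_, ⟨⟨q₁, X, a⟩, r, hr, h, h1⟩, rest, h2, h3, h4, h5, h6⟩
    rw [Option.some_inj] at h1
    subst h1
    simp only [EmbeddingLike.apply_eq_iff_eq, Option.some.injEq, reduceCtorEq, false_and,
      or_false] at h2 h3 h4 h5 h6
    subst h2
    obtain ⟨rfl, h6⟩ := h6
    refine ⟨⟨r.1, h⟩, _, ⟨X, rest, r, h4, hr, rfl⟩, ?_⟩
    cases d
    simp_all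
  · rintro ⟨q', st', ⟨X, rest, r, rfl, hr, h⟩, rfl⟩
    simp only [Prod.mk.injEq, true_and] at h
    refine ⟨_, ⟨(q, X, α m), r, hr, h.1 ▸ q'.2, rfl⟩, rest, rfl, ?_, rfl, h.2, Or.inl ⟨rfl, rfl⟩⟩
    simp [← h.1]

/-- `DPDA.ofStep` drops the moves that leave `S`; the closure condition ensures that no run from
`q₀` is lost. -/
theorem DPDA.ofStep_accepts_iff (p : Fin n) (S : Finset Q)
    {δ : Q → Fin 2 → Bool → Option (Q × List (Fin 2))}
    (hS : ∀ q ∈ S, ∀ X b r, δ q X b = some r → r.1 ∈ S) (q₀ : {q // q ∈ S}) (f : Set Q)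
    (α : Word n) (i l : ℕ) :
    (DPDA.ofStep p S δ q₀ f).Accepts α (fun _ _ => True) i l ↔
      ∃ q ∈ f, ∃ st, RtReaches δ (bitsAt p α) (i, q₀, [0]) (l, q, st) := by
  classical
  simp only [DPDA.Accepts, and_true, true_and]
  constructor
  · rintro ⟨c, rfl, hf, hc⟩
    have : ∃ q : {q // q ∈ S}, c.state = S.equivFin q ∧
        RtReaches δ (bitsAt p α) (i, q₀, [0]) (c.pos, q, c.stack) := by
      clear hf
      induction hc with
      | refl => exact ⟨q₀, rfl, .refl⟩
      | @tail d d' _ h ih =>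
        obtain ⟨q, hq, hr⟩ := ih
        obtain ⟨m, s, st⟩ := d
        simp only at hq hr
        subst hq
        obtain ⟨q', st', h1, rfl⟩ := (DPDA.ofStep_step_iff ..).1 h
        exact ⟨q', rfl, hr.tail h1⟩
    obtain ⟨q, hq, hr⟩ := this
    refine ⟨q, ?_, _, hr⟩
    simpa [DPDA.ofStep, hq] using hf
  · rintro ⟨q, hf, st, hr⟩
    have : ∀ c, RtReaches δ (bitsAt p α) (i, q₀, [0]) c → ∃ h : c.2.1 ∈ S,
        ReflTransGen ((DPDA.ofStep p S δ q₀ f).Step α) ⟨i, S.equivFin q₀, [0]⟩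
          ⟨c.1, S.equivFin ⟨c.2.1, h⟩, c.2.2⟩ := by
      intro c hc
      induction hc with
      | refl => exact ⟨q₀.2, .refl⟩
      | @tail d d' _ h ih =>
        obtain ⟨hd, ih⟩ := ih
        obtain ⟨m, q, st⟩ := d
        obtain ⟨X, rest, r, h1, h2, rfl⟩ := rtStep_eq_some.1 h
        exact ⟨hS q hd X _ r h2, ih.tail
          ((DPDA.ofStep_step_iff p S δ q₀ f α m ⟨q, hd⟩ st _).2 ⟨⟨r.1, _⟩, _, h, rfl⟩)⟩
    obtain ⟨h, hr⟩ := this _ hr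
    exact ⟨_, rfl, by simpa [DPDA.ofStep] using hf, hr⟩

end RealTime

/-! ## Formulas without tests -/

section Formulas

variable {n k g : ℕ}

/-- The empty test function. -/
def noTests (n k : ℕ) (q : {q : Fin k // q ∈ (∅ : Finset (Fin k))}) : Formula n :=
  absurd q.2 (Finset.notMem_empty _)

theorem sat_dia_noTests (A : DPDA n k g) (φ : Formula n) (α : Word n) (i : ℕ) :
    (Formula.dia A ∅ (noTests n k) φ).Sat α i ↔
      ∃ l, i ≤ l ∧ A.Accepts α (fun _ _ => True) i l ∧ φ.Sat α l := by
  simp [Formula.Sat]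

theorem sat_box_noTests (A : DPDA n k g) (φ : Formula n) (α : Word n) (i : ℕ) :
    (Formula.box A ∅ (noTests n k) φ).Sat α i ↔
      ∀ l, i ≤ l → A.Accepts α (fun _ _ => True) i l → φ.Sat α l := by
  simp [Formula.Sat]

/-- The automaton that accepts the words of length one. -/
noncomputable def letterAut (p : Fin n) : DPDA n (Finset.univ : Finset Bool).card 2 :=
  DPDA.ofStep p Finset.univ (fun q X _ => if q then none else some (true, [X]))
    ⟨false, Finset.mem_univ _⟩ {true}

/-- The formula for "`φ` holds at the next position". -/
noncomputable def next (p : Fin n) (φ : Formula n) : Formula n :=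
  .dia (letterAut p) ∅ (noTests _ _) φ

theorem sat_next (p : Fin n) (φ : Formula n) (α : Word n) (i : ℕ) :
    (next p φ).Sat α i ↔ φ.Sat α (i + 1) := by
  rw [next, sat_dia_noTests]
  have : ∀ l, (letterAut p).Accepts α (fun _ _ => True) i l ↔ l = i + 1 := by
    intro l
    rw [letterAut, DPDA.ofStep_accepts_iff p _ (fun _ _ _ _ _ _ => Finset.mem_univ _)]
    constructor
    · rintro ⟨q, rfl, st, h⟩
      obtain h | ⟨c, h1, h2⟩ := h.cases_head
      · simp at h
      · obtain ⟨X, rest, r, -, hr, rfl⟩ := rtStep_eq_some.1 h1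
        simp only [Bool.false_eq_true, if_false, Option.some.injEq] at hr
        subst hr
        obtain h | ⟨c, h1, h2⟩ := h2.cases_head
        · simp only [Prod.mk.injEq] at h
          exact h.1.symm
        · obtain ⟨X, rest, r, -, hr, rfl⟩ := rtStep_eq_some.1 h1
          simp at hr
    · rintro rfl
      exact ⟨true, rfl, [0], .single rfl⟩
  simp only [this]
  exact ⟨fun ⟨l, _, h, h'⟩ => h ▸ h', fun h => ⟨i + 1, Nat.le_succ i, rfl, h⟩⟩

/-- The formula for "`p` holds at the next `m` positions, and `φ` holds after that". -/
noncomputable def ones (p : Fin n) (φ : Formula n) (m : ℕ) : Formula n :=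
  Nat.rec φ (fun _ ψ => .and (.atom p) (next p ψ)) m

/-- The `a` bits from position `i` on are ones. -/
def Ones (w : ℕ → Bool) (i a : ℕ) : Prop := ∀ t < a, w (i + t) = true

/-- There are exactly `a` ones from position `i` on before the next zero. -/
def Block (w : ℕ → Bool) (i a : ℕ) : Prop := Ones w i a ∧ w (i + a) = false

theorem ones_zero (w : ℕ → Bool) (i : ℕ) : Ones w i 0 := fun _ h => absurd h (Nat.not_lt_zero _)

theorem Ones.succ {w : ℕ → Bool} {i a : ℕ} (h : Ones w i a) (h' : w (i + a) = true) :
    Ones w i (a + 1) := by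
  intro t ht
  obtain h1 | rfl := Nat.lt_succ_iff_lt_or_eq.1 ht
  · exact h t h1
  · exact h'

theorem ones_succ_iff {w : ℕ → Bool} {i a : ℕ} :
    Ones w i (a + 1) ↔ w i = true ∧ Ones w (i + 1) a := by
  constructor
  · intro h
    exact ⟨h 0 (Nat.succ_pos _), fun t ht => by
      have := h (t + 1) (by omega)
      rwa [show i + 1 + t = i + (t + 1) by omega]⟩
  · rintro ⟨h0, h⟩ t ht
    cases t with
    | zero => exact h0
    | succ t =>
      have := h t (by omega)
      rwa [show i + 1 + t = i + (t + 1) by omega] at this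

theorem Block.unique {w : ℕ → Bool} {i a b : ℕ} (ha : Block w i a) (hb : Block w i b) : a = b := by
  by_contra hne
  obtain h | h := Nat.lt_or_gt_of_ne hne
  · simpa [ha.2] using hb.1 a h
  · simpa [hb.2] using ha.1 b h

theorem sat_ones (p : Fin n) (φ : Formula n) (m : ℕ) (α : Word n) (i : ℕ) :
    (ones p φ m).Sat α i ↔ Ones (bitsAt p α) i m ∧ φ.Sat α (i + m) := by
  induction m generalizing i with
  | zero => simp [ones, ones_zero]
  | succ m ih =>
    change (Formula.and (.atom p) (next p (ones p φ m))).Sat α i ↔ _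
    rw [Formula.Sat, sat_next, ih, ones_succ_iff, and_assoc, Formula.Sat, bitsAt, decide_eq_true_iff,
      show i + 1 + m = i + (m + 1) by omega]

/-- The automaton that accepts the empty word and the words in which `p` does not hold at the last
position. -/
noncomputable def startAut (p : Fin n) : DPDA n (Finset.univ : Finset Bool).card 2 :=
  DPDA.ofStep p Finset.univ (fun _ X b => some (!b, [X])) ⟨true, Finset.mem_univ _⟩ {true}

/-- The state is the negation of the last bit read, and `true` before any bit is read. -/
theorem startAut_accepts_iff (p : Fin n) (α : Word n) (l : ℕ) :
    (startAut p).Accepts α (fun _ _ => True) 0 l ↔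
      l = 0 ∨ ∃ m, l = m + 1 ∧ bitsAt p α m = false := by
  rw [startAut, DPDA.ofStep_accepts_iff p _ (fun _ _ _ _ _ _ => Finset.mem_univ _)]
  generalize bitsAt p α = w
  constructor
  · rintro ⟨q, rfl, st, h⟩
    cases h with
    | refl => exact Or.inl rfl
    | @tail c _ _ h1 =>
      obtain ⟨m, q, st'⟩ := c
      obtain ⟨X, rest, r, -, hr, h⟩ := rtStep_eq_some.1 h1
      rw [Option.some_inj] at hr
      subst hr
      simp only [Prod.mk.injEq] at h
      exact Or.inr ⟨m, h.1, by simpa using h.2.1⟩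
  · have : ∀ l, ∃ q, RtReaches (fun _ X b => some (!b, [X])) w (0, true, [0]) (l, q, [0]) := by
      intro l
      induction l with
      | zero => exact ⟨true, .refl⟩
      | succ l ih =>
        obtain ⟨q, ih⟩ := ih
        exact ⟨!w l, ih.tail rfl⟩
    rintro (rfl | ⟨m, rfl, hm⟩)
    · exact ⟨true, rfl, [0], .refl⟩
    · obtain ⟨q, h⟩ := this m
      refine ⟨true, rfl, [0], h.tail ?_⟩
      simp [rtStep, hm]

end Formulas

/-! ## The automaton that checks a recurrence -/

/-- The states of the automaton that checks a recurrence: counting the first block modulo `M`,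
counting the second block modulo `M`, comparing the third block. -/
inductive RecState : Type
  | first (r : ℕ)
  | second (r r' : ℕ)
  | third (p s m : ℕ)
  | done

/-- The moves of the automaton that checks a recurrence. It pushes a symbol for every `M` ones in
the first block, pops a symbol for every `p` ones in the third one, and then reads `s` ones. In the
state `third p s m`, another `m` ones are to be read before the next pop. -/
def recStep (M : ℕ) (F : ℕ → ℕ → Option (ℕ × ℕ)) :
    RecState → Fin 2 → Bool → Option (RecState × List (Fin 2))
  | .first r, X, true => if r + 1 < M then some (.first (r + 1), [X]) else some (.first 0, [1, X])
  | .first r, X, false => some (.second r 0, [X])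
  | .second r r', X, true => some (.second r ((r' + 1) % M), [X])
  | .second r r', X, false => (F r r').map fun c => (.third c.1 c.2 0, [X])
  | .third p s (m + 1), X, true => some (.third p s m, [X])
  | .third p s 0, 1, true => some (.third p s (p - 1), [])
  | .third p (s + 1) 0, 0, true => some (.third p s 0, [0])
  | .third _ 0 0, 0, false => some (.done, [0])
  | _, _, _ => none

/-- The states with all parameters below a bound. -/
def RecState.Bounded (M K : ℕ) : RecState → Prop
  | .first r => r < M
  | .second r r' => r < M ∧ r' < M
  | .third p s m => p < K ∧ s < K ∧ m < K
  | .done => True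

theorem RecState.finite_bounded (M K : ℕ) : {q | RecState.Bounded M K q}.Finite := by
  have hM := Set.finite_Iio M
  have hK := Set.finite_Iio K
  refine ((hM.image .first).union (((hM.prod hM).image fun x => .second x.1 x.2).union
    (((hK.prod (hK.prod hK)).image fun x => .third x.1 x.2.1 x.2.2).union
      (Set.finite_singleton .done)))).subset ?_
  rintro (r | ⟨r, r'⟩ | ⟨p, s, m⟩ | _) h
  · exact Or.inl ⟨r, h, rfl⟩
  · exact Or.inr (Or.inl ⟨(r, r'), h, rfl⟩)
  · exact Or.inr (Or.inr (Or.inl ⟨(p, s, m), h, rfl⟩))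
  · exact Or.inr (Or.inr (Or.inr rfl))

/-- The rule is consulted only at residues below `M`. Its finitely many values there bound the
counters, which keeps the control finite. -/
theorem exists_rule_bound (M : ℕ) (F : ℕ → ℕ → Option (ℕ × ℕ)) :
    ∃ K, ∀ u < M, ∀ v < M, ∀ p s, F u v = some (p, s) → p < K ∧ s < K := by
  let f : ℕ × ℕ → ℕ := fun x => ((F x.1 x.2).map fun c => c.1 + c.2).getD 0
  refine ⟨((Finset.range M ×ˢ Finset.range M).sup f) + 1, fun u hu v hv p s h => ?_⟩
  have : f (u, v) ≤ _ := Finset.le_sup (f := f)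
    (Finset.mem_product.2 ⟨Finset.mem_range.2 hu, Finset.mem_range.2 hv⟩)
  have e : f (u, v) = p + s := by simp [f, h]
  omega

section RecurrenceAutomaton

variable {M : ℕ} {F : ℕ → ℕ → Option (ℕ × ℕ)}

theorem recStep_bounded {K : ℕ} (hM : 0 < M)
    (hK : ∀ u < M, ∀ v < M, ∀ p s, F u v = some (p, s) → p < K ∧ s < K)
    (q : RecState) (hq : q.Bounded M K) (X : Fin 2) (b : Bool) (r : RecState × List (Fin 2))
    (h : recStep M F q X b = some r) : r.1.Bounded M K := by
  unfold recStep at h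
  split at h
  · split_ifs at h with h1 <;> cases h
    · exact h1
    · exact hM
  · cases h
    exact ⟨hq, hM⟩
  · cases h
    exact ⟨hq.1, Nat.mod_lt _ hM⟩
  · obtain ⟨⟨p, s⟩, h1, rfl⟩ := Option.map_eq_some_iff.1 h
    have := hK _ hq.1 _ hq.2 _ _ h1
    exact ⟨this.1, this.2, by omega⟩
  · cases h
    exact ⟨hq.1, hq.2.1, by have := hq.2.2; omega⟩
  · cases h
    exact ⟨hq.1, hq.2.1, by have := hq.1; omega⟩
  · cases h
    exact ⟨hq.1, by have := hq.2.1; omega, hq.2.2⟩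
  · cases h
    trivial
  · cases h

/-- The three blocks from position `i` on are related by the recurrence. -/
def RecBlocks (M : ℕ) (F : ℕ → ℕ → Option (ℕ × ℕ)) (w : ℕ → Bool) (i : ℕ) : Prop :=
  ∃ a b c, Block w i a ∧ Block w (i + a + 1) b ∧ Block w (i + a + 1 + b + 1) c ∧ RecRel M F a b c

/-- The invariant of the runs from position `i`. -/
def RecInv (M : ℕ) (F : ℕ → ℕ → Option (ℕ × ℕ)) (w : ℕ → Bool) (i : ℕ) :
    ℕ × RecState × List (Fin 2) → Prop
  | (m, .first r, st) => ∃ a, m = i + a ∧ Ones w i a ∧ r = a % M ∧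
      st = List.replicate (a / M) 1 ++ [0]
  | (m, .second r r', st) => ∃ a b, m = i + a + 1 + b ∧ Block w i a ∧ Ones w (i + a + 1) b ∧
      r = a % M ∧ r' = b % M ∧ st = List.replicate (a / M) 1 ++ [0]
  | (m, .third p s x, st) => ∃ a b c s' k, m = i + a + 1 + b + 1 + c ∧ Block w i a ∧
      Block w (i + a + 1) b ∧ Ones w (i + a + 1 + b + 1) c ∧ F (a % M) (b % M) = some (p, s') ∧
      st = List.replicate k 1 ++ [0] ∧ c + x + p * k + s = p * (a / M) + s'
  | (_, .done, _) => RecBlocks M F w i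

theorem succ_mod_div (hM : 0 < M) (a : ℕ) :
    (a % M + 1 < M ∧ (a + 1) % M = a % M + 1 ∧ (a + 1) / M = a / M) ∨
      (¬ a % M + 1 < M ∧ (a + 1) % M = 0 ∧ (a + 1) / M = a / M + 1) := by
  have h1 := Nat.div_add_mod a M
  have h2 := Nat.mod_lt a hM
  by_cases h : a % M + 1 < M
  · refine Or.inl ⟨h, ?_, ?_⟩
    · conv_lhs => rw [← h1, add_assoc, Nat.mul_add_mod, Nat.mod_eq_of_lt h]
    · conv_lhs => rw [← h1, add_assoc, Nat.mul_add_div hM, Nat.div_eq_of_lt h, add_zero]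
  · have e : a % M + 1 = M := by omega
    refine Or.inr ⟨h, ?_, ?_⟩
    · conv_lhs => rw [← h1, add_assoc, Nat.mul_add_mod, e, Nat.mod_self]
    · conv_lhs => rw [← h1, add_assoc, Nat.mul_add_div hM, e, Nat.div_self hM]

theorem replicate_append_eq_cons {k : ℕ} {X : Fin 2} {rest : List (Fin 2)}
    (h : List.replicate k (1 : Fin 2) ++ [0] = X :: rest) :
    (k = 0 ∧ X = 0 ∧ rest = []) ∨
      ∃ k', k = k' + 1 ∧ X = 1 ∧ rest = List.replicate k' 1 ++ [0] := by
  cases k with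
  | zero => simp_all
  | succ k =>
    rw [List.replicate_succ, List.cons_append, List.cons.injEq] at h
    exact Or.inr ⟨k, rfl, h.1.symm, h.2.symm⟩

/-- In the third block a balance is kept: the ones read, plus `x` due before the next pop, `p` for
each stored symbol and `s` at the end, make up the required length. A pop itself reads the first of
its `p` ones and leaves `p - 1` due, hence the need for `0 < p`. -/
theorem RecInv.step {w : ℕ → Bool} {i : ℕ} (hM : 0 < M)
    (hF : ∀ u v p s, F u v = some (p, s) → 0 < p)
    {c c' : ℕ × RecState × List (Fin 2)} (hc : RecInv M F w i c)
    (h : rtStep (recStep M F) w c = some c') : RecInv M F w i c' := by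
  obtain ⟨m, q, st⟩ := c
  obtain ⟨X, rest, r, rfl, hr, rfl⟩ := rtStep_eq_some.1 h
  clear h
  rcases q with r₁ | ⟨r₁, r₂⟩ | ⟨p, s, x⟩ | _
  · obtain ⟨a, rfl, ha, rfl, hst⟩ := hc
    cases hw : w (i + a) with
    | true =>
      simp only [hw, recStep] at hr
      obtain ⟨h1, h2, h3⟩ | ⟨h1, h2, h3⟩ := succ_mod_div hM a
      · rw [if_pos h1, Option.some_inj] at hr
        subst hr
        exact ⟨a + 1, rfl, ha.succ hw, h2.symm, by rw [h3]; exact hst⟩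
      · rw [if_neg h1, Option.some_inj] at hr
        subst hr
        exact ⟨a + 1, rfl, ha.succ hw, h2.symm, by
          rw [h3, List.replicate_succ]; exact congrArg (List.cons 1) hst⟩
    | false =>
      simp only [hw, recStep, Option.some_inj] at hr
      subst hr
      exact ⟨a, 0, rfl, ⟨ha, hw⟩, ones_zero _ _, rfl, (Nat.zero_mod _).symm, hst⟩
  · obtain ⟨a, b, rfl, ha, hb, rfl, rfl, hst⟩ := hc
    cases hw : w (i + a + 1 + b) with
    | true =>
      simp only [hw, recStep, Option.some_inj] at hr
      subst hr
      exact ⟨a, b + 1, rfl, ha, hb.succ hw, rfl, by simp, hst⟩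
    | false =>
      simp only [hw, recStep] at hr
      obtain ⟨⟨p, s⟩, h1, rfl⟩ := Option.map_eq_some_iff.1 hr
      exact ⟨a, b, 0, s, a / M, rfl, ha, ⟨hb, hw⟩, ones_zero _ _, h1, hst, by simp⟩
  · obtain ⟨a, b, c, s', k, rfl, ha, hb, hc, hp, hst, heq⟩ := hc
    have hp0 := hF _ _ _ _ hp
    cases hw : w (i + a + 1 + b + 1 + c) with
    | true =>
      have hc' := hc.succ hw
      rw [hw] at hr
      cases x with
      | succ x =>
        simp only [recStep, Option.some_inj] at hr
        subst hr
        exact ⟨a, b, c + 1, s', k, rfl, ha, hb, hc', hp, hst, by omega⟩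
      | zero =>
        obtain ⟨rfl, rfl, rfl⟩ | ⟨k, rfl, rfl, rfl⟩ := replicate_append_eq_cons hst.symm
        · cases s with
          | zero => simp [recStep] at hr
          | succ s =>
            simp only [recStep, Option.some_inj] at hr
            subst hr
            exact ⟨a, b, c + 1, s', 0, rfl, ha, hb, hc', hp, rfl, by omega⟩
        · simp only [recStep, Option.some_inj] at hr
          subst hr
          exact ⟨a, b, c + 1, s', k, rfl, ha, hb, hc', hp, rfl, by
            rw [Nat.mul_succ] at heq
            omega⟩
    | false =>
      rw [hw] at hr
      cases x with
      | succ x => simp [recStep] at hr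
      | zero =>
        obtain ⟨rfl, rfl, rfl⟩ | ⟨k, rfl, rfl, rfl⟩ := replicate_append_eq_cons hst.symm
        · cases s with
          | zero =>
            simp only [recStep, Option.some_inj] at hr
            subst hr
            exact ⟨a, b, c, ha, hb, ⟨hc, hw⟩, p, s', hp, by simpa using heq⟩
          | succ s => simp [recStep] at hr
        · simp [recStep] at hr
  · simp [recStep] at hr

theorem recReaches_first {w : ℕ → Bool} {i a : ℕ} (hM : 0 < M) (ha : Ones w i a) :
    RtReaches (recStep M F) w (i, .first 0, [0])
      (i + a, .first (a % M), List.replicate (a / M) 1 ++ [0]) := by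
  induction a with
  | zero => simpa using ReflTransGen.refl
  | succ a ih =>
    refine (ih fun t ht => ha t (by omega)).tail (rtStep_eq_some.2 ?_)
    obtain ⟨X, rest, h⟩ := List.exists_cons_of_ne_nil
      (show List.replicate (a / M) (1 : Fin 2) ++ [0] ≠ [] by simp)
    rw [ha a (Nat.lt_succ_self a)]
    obtain ⟨h1, h2, h3⟩ | ⟨h1, h2, h3⟩ := succ_mod_div hM a
    · exact ⟨X, rest, _, h, by rw [recStep, if_pos h1], by rw [h2, h3, h]; rfl⟩
    · exact ⟨X, rest, _, h, by rw [recStep, if_neg h1], by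
        rw [h2, h3, List.replicate_succ, List.cons_append, h]; rfl⟩

theorem recReaches_second {w : ℕ → Bool} {i b r : ℕ} {X : Fin 2} {rest : List (Fin 2)}
    (hb : Ones w i b) :
    RtReaches (recStep M F) w (i, .second r 0, X :: rest) (i + b, .second r (b % M), X :: rest) := by
  induction b with
  | zero => simpa using ReflTransGen.refl
  | succ b ih =>
    refine (ih fun t ht => hb t (by omega)).tail ?_
    simp [rtStep, hb b (Nat.lt_succ_self b), recStep, add_assoc]

/-- Induction on the ones still to be read; each is charged to `x`, then to a stored symbol, then to
`s`. -/
theorem recReaches_third {w : ℕ → Bool} {p : ℕ} (hp : 0 < p) (c : ℕ) :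
    ∀ {i s x k : ℕ}, c = x + p * k + s → Ones w i c →
      RtReaches (recStep M F) w (i, .third p s x, List.replicate k 1 ++ [0])
        (i + c, .third p 0 0, [0]) := by
  induction c with
  | zero =>
    intro i s x k h _
    have hk : k = 0 := by
      by_contra hk
      have := Nat.mul_pos hp (Nat.pos_of_ne_zero hk)
      omega
    subst hk
    obtain rfl : x = 0 := by omega
    obtain rfl : s = 0 := by omega
    exact .refl
  | succ c ih =>
    intro i s x k h hc
    obtain ⟨hw, hc⟩ := ones_succ_iff.1 hc
    rw [show i + (c + 1) = i + 1 + c by omega]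
    cases x with
    | succ x =>
      refine .head ?_ (ih (s := s) (x := x) (k := k) (by omega) hc)
      cases k <;> simp [rtStep, hw, recStep, List.replicate_succ]
    | zero =>
      cases k with
      | succ k =>
        refine .head ?_ (ih (s := s) (x := p - 1) (k := k) (by rw [Nat.mul_succ] at h; omega) hc)
        simp [rtStep, hw, recStep, List.replicate_succ]
      | zero =>
        cases s with
        | zero => simp at h
        | succ s =>
          refine .head ?_ (ih (s := s) (x := 0) (k := 0) (by omega) hc)
          simp [rtStep, hw, recStep]

/-- The invariant gives one direction; running through the three blocks in turn gives the other. -/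
theorem recReaches_done_iff {w : ℕ → Bool} {i : ℕ} (hM : 0 < M)
    (hF : ∀ u v p s, F u v = some (p, s) → 0 < p) :
    (∃ l st, RtReaches (recStep M F) w (i, .first 0, [0]) (l, .done, st)) ↔ RecBlocks M F w i := by
  constructor
  · rintro ⟨l, st, h⟩
    have : ∀ c, RtReaches (recStep M F) w (i, .first 0, [0]) c → RecInv M F w i c := by
      intro c hc
      induction hc with
      | refl => exact ⟨0, rfl, ones_zero _ _, (Nat.zero_mod _).symm, by simp⟩
      | tail _ h ih => exact ih.step hM hF h
    exact this _ h
  · rintro ⟨a, b, c, ha, hb, hc, p, s, hp, rfl⟩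
    obtain ⟨X, rest, h⟩ := List.exists_cons_of_ne_nil
      (show List.replicate (a / M) (1 : Fin 2) ++ [0] ≠ [] by simp)
    have h1 := recReaches_first (F := F) hM ha.1
    have h2 := h1.tail (c := (i + a + 1, .second (a % M) 0, List.replicate (a / M) 1 ++ [0])) (by
      rw [h]; simp [rtStep, ha.2, recStep])
    rw [h] at h2
    have h3 := (h2.trans (recReaches_second hb.1)).tail
      (c := (i + a + 1 + b + 1, .third p s 0, X :: rest)) (by simp [rtStep, hb.2, recStep, hp])
    rw [← h] at h3
    have h4 := h3.trans (recReaches_third (hF _ _ _ _ hp) _ (by omega) hc.1)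
    exact ⟨i + a + 1 + b + 1 + (p * (a / M) + s) + 1, [0], h4.tail (by simp [rtStep, hc.2, recStep])⟩

/-- Some automaton detects the positions at which three blocks related by the recurrence start. -/
theorem exists_recurrence_automaton {n : ℕ} (p : Fin n) (hM : 0 < M)
    (hF : ∀ u v p s, F u v = some (p, s) → 0 < p) :
    ∃ (k : ℕ) (A : DPDA n k 2), ∀ (α : Word n) (i : ℕ),
      (∃ l, i ≤ l ∧ A.Accepts α (fun _ _ => True) i l) ↔ RecBlocks M F (bitsAt p α) i := by
  obtain ⟨K, hK⟩ := exists_rule_bound M F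
  let S := (RecState.finite_bounded M K).toFinset
  have hS : ∀ q, q ∈ S ↔ q.Bounded M K := fun q => Set.Finite.mem_toFinset _
  refine ⟨S.card, .ofStep p S (recStep M F) ⟨.first 0, (hS _).2 hM⟩ {.done}, fun α i => ?_⟩
  rw [← recReaches_done_iff hM hF]
  simp only [DPDA.ofStep_accepts_iff p S fun q hq X b r h =>
    (hS _).2 (recStep_bounded hM hK q ((hS _).1 hq) X b r h)]
  constructor
  · rintro ⟨l, -, q, rfl, st, h⟩
    exact ⟨l, st, h⟩
  · rintro ⟨l, st, h⟩
    exact ⟨l, h.pos_le, .done, rfl, st, h⟩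

end RecurrenceAutomaton

/-! ## Words that present solutions of a recurrence -/

section Sequences

variable {n : ℕ}

/-- Position `0`, and every position after a zero. -/
def IsStart (w : ℕ → Bool) (l : ℕ) : Prop := l = 0 ∨ ∃ m, l = m + 1 ∧ w m = false

theorem Block.isStart {w : ℕ → Bool} {i a : ℕ} (h : Block w i a) : IsStart w (i + a + 1) :=
  Or.inr ⟨i + a, rfl, h.2⟩

/-- The start of the `j`-th block of the word that presents the sequence `a`. -/
def blockPos (a : ℕ → ℕ) : ℕ → ℕ
  | 0 => 0
  | j + 1 => blockPos a j + a j + 1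

theorem blockPos_strictMono (a : ℕ → ℕ) : StrictMono (blockPos a) :=
  strictMono_nat_of_lt_succ fun j => by rw [blockPos]; omega

/-- The word over `{∅, {p}}` that presents the sequence `a`. -/
noncomputable def seqWord (p : Fin n) (a : ℕ → ℕ) : Word n := fun m =>
  open Classical in if ∃ j, m + 1 = blockPos a (j + 1) then ∅ else {p}

theorem bitsAt_seqWord_eq_false (p : Fin n) (a : ℕ → ℕ) (m : ℕ) :
    bitsAt p (seqWord p a) m = false ↔ ∃ j, m + 1 = blockPos a (j + 1) := by
  unfold bitsAt seqWord
  split_ifs with h <;> simpa using h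

/-- The zeros sit just before the later block starts, and by strict monotonicity none of them falls
inside a block. -/
theorem block_seqWord (p : Fin n) (a : ℕ → ℕ) (j : ℕ) :
    Block (bitsAt p (seqWord p a)) (blockPos a j) (a j) := by
  constructor
  · intro t ht
    rw [← Bool.not_eq_false, bitsAt_seqWord_eq_false]
    rintro ⟨j', h⟩
    obtain h1 | h1 := Nat.lt_or_ge j' j
    · have := (blockPos_strictMono a).monotone (Nat.succ_le_of_lt h1)
      simp only [Nat.succ_eq_add_one] at this
      omega
    · have := (blockPos_strictMono a).monotone (Nat.succ_le_succ h1)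
      simp only [Nat.succ_eq_add_one] at this
      rw [blockPos] at this
      omega
  · exact (bitsAt_seqWord_eq_false p a _).2 ⟨j, rfl⟩

/-- The words that start with a block of length `b` followed by one of length `N`, and in which
any three consecutive blocks are related by the recurrence, present exactly the solutions of the
recurrence with initial values `b` and `N`. -/
theorem exists_word_iff_exists_sequence (p : Fin n) (M : ℕ) (F : ℕ → ℕ → Option (ℕ × ℕ))
    (b N : ℕ) :
    (∃ α : Word n, (Block (bitsAt p α) 0 b ∧ Block (bitsAt p α) (b + 1) N) ∧
      ∀ l, IsStart (bitsAt p α) l → RecBlocks M F (bitsAt p α) l) ↔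
    ∃ a : ℕ → ℕ, a 0 = b ∧ a 1 = N ∧ ∀ j, RecRel M F (a j) (a (j + 1)) (a (j + 2)) := by
  constructor
  · rintro ⟨α, ⟨h0, h1⟩, h⟩
    generalize bitsAt p α = w at *
    have hb : ∀ l, ∃ a, IsStart w l → Block w l a := by
      intro l
      by_cases hl : IsStart w l
      · obtain ⟨a, _, _, ha, -⟩ := h l hl
        exact ⟨a, fun _ => ha⟩
      -- A dummy length, never used: only block starts are visited below.
      · exact ⟨0, fun h => absurd h hl⟩
    choose len hlen using hb
    let P : ℕ → ℕ := fun j => Nat.rec 0 (fun _ l => l + len l + 1) j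
    have hP : ∀ j, IsStart w (P j) := by
      intro j
      induction j with
      | zero => exact Or.inl rfl
      | succ j ih => exact (hlen _ ih).isStart
    have hB : ∀ j, Block w (P j) (len (P j)) := fun j => hlen _ (hP j)
    refine ⟨fun j => len (P j), (hB 0).unique h0, ?_, fun j => ?_⟩
    · have e : len 0 = b := (hB 0).unique h0
      refine (hB 1).unique ?_
      change Block w (0 + len 0 + 1) N
      rwa [e, zero_add]
    · obtain ⟨x, y, z, hx, hy, hz, hr⟩ := h _ (hP j)
      -- A block length is determined by its start, so the triples found at successive starts agree
      -- on their overlaps.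
      obtain rfl := hx.unique (hB j)
      obtain rfl := hy.unique (hB (j + 1))
      obtain rfl := hz.unique (hB (j + 2))
      exact hr
  · rintro ⟨a, rfl, rfl, ha⟩
    refine ⟨seqWord p a, ⟨block_seqWord p a 0, ?_⟩, ?_⟩
    · have := block_seqWord p a 1
      rwa [blockPos, blockPos, zero_add] at this
    · have key : ∀ j, RecBlocks M F (bitsAt p (seqWord p a)) (blockPos a j) := fun j =>
        ⟨_, _, _, block_seqWord p a j, block_seqWord p a (j + 1), block_seqWord p a (j + 2), ha j⟩
      rintro l (rfl | ⟨m, rfl, hm⟩)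
      · exact key 0
      · obtain ⟨j, hj⟩ := (bitsAt_seqWord_eq_false p a m).1 hm
        rw [hj]
        exact key (j + 1)

end Sequences

/-! ## Validity -/

section Validity

variable {n : ℕ}

/-- The formula that holds everywhere. -/
def verum (p : Fin n) : Formula n := .or (.atom p) (.neg (.atom p))

/-- The formula for the presentations of the solutions of a recurrence with initial values `b` and
`N`, where the automaton `A` checks the recurrence. -/
noncomputable def solutionFormula (p : Fin n) {k g : ℕ} (A : DPDA n k g) (b N : ℕ) : Formula n :=
  .and (ones p (.and (.neg (.atom p)) (next p (ones p (.neg (.atom p)) N))) b)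
    (.box (startAut p) ∅ (noTests _ _) (.dia A ∅ (noTests _ _) (verum p)))

/-- The nested next-formulas fix the first two blocks. The box reaches exactly the block starts, and
the diamond there also forces every block to end. -/
theorem models_solutionFormula (p : Fin n) {k g : ℕ} {A : DPDA n k g} {M : ℕ}
    {F : ℕ → ℕ → Option (ℕ × ℕ)}
    (hA : ∀ (α : Word n) (i : ℕ), (∃ l, i ≤ l ∧ A.Accepts α (fun _ _ => True) i l) ↔
      RecBlocks M F (bitsAt p α) i) (b N : ℕ) (α : Word n) :
    Formula.Models α (solutionFormula p A b N) ↔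
      (Block (bitsAt p α) 0 b ∧ Block (bitsAt p α) (b + 1) N) ∧
        ∀ l, IsStart (bitsAt p α) l → RecBlocks M F (bitsAt p α) l := by
  have hneg : ∀ i, (Formula.neg (.atom p)).Sat α i ↔ bitsAt p α i = false := by
    simp [Formula.Sat, bitsAt]
  have hv : ∀ i, (verum p).Sat α i := fun i => by simp [verum, Formula.Sat, em]
  have hd : ∀ i, (Formula.dia A ∅ (noTests _ _) (verum p)).Sat α i ↔
      RecBlocks M F (bitsAt p α) i := by
    intro i
    rw [sat_dia_noTests, ← hA]
    simp only [hv, and_true]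
  rw [Formula.Models, solutionFormula, Formula.Sat, sat_ones, Formula.Sat, sat_next, sat_ones,
    hneg, hneg, sat_box_noTests]
  simp only [hd, startAut_accepts_iff, Nat.zero_le, true_imp_iff, zero_add, Block, IsStart,
    and_assoc]

/-! ### Computability of the codes of the formulas. -/

theorem primrec_code_and {f g : ℕ → Formula n} (hf : Primrec fun x => (f x).code)
    (hg : Primrec fun x => (g x).code) : Primrec fun x => (Formula.and (f x) (g x)).code :=
  Primrec.encode.comp (.pair (.const _) (.pair hf hg))

theorem code_next (p : Fin n) (φ : Formula n) : (next p φ).code =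
    Encodable.encode (4, (Finset.univ : Finset Bool).card, 2, (letterAut p).code,
      (List.ofFn fun _ : Fin (Finset.univ : Finset Bool).card => 0), φ.code) := by
  simp only [Formula.code, next, Finset.notMem_empty, dite_false]

theorem primrec_code_next (p : Fin n) {f : ℕ → Formula n} (hf : Primrec fun x => (f x).code) :
    Primrec fun x => (next p (f x)).code := by
  simp only [code_next]
  exact Primrec.encode.comp (.pair (.const _) (.pair (.const _) (.pair (.const _) (.pair (.const _)
    (.pair (.const _) hf)))))

/-- The formula grows with `m`, but each layer acts on codes as one fixed arithmetic operation, so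
primitive recursion on numbers suffices. -/
theorem primrec_code_ones (p : Fin n) (φ : Formula n) : Primrec fun m => (ones p φ m).code := by
  refine (Primrec.nat_rec₁ (f := fun _ c => Encodable.encode (2, (Formula.atom p).code,
    Encodable.encode (4, (Finset.univ : Finset Bool).card, 2, (letterAut p).code,
      (List.ofFn fun _ : Fin (Finset.univ : Finset Bool).card => 0), c))) φ.code ?_).of_eq
      fun m => ?_
  · refine Primrec.encode.comp (.pair (.const _) (.pair (.const _) (Primrec.encode.comp ?_)))
    exact .pair (.const _) (.pair (.const _) (.pair (.const _) (.pair (.const _)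
      (.pair (.const _) .snd))))
  · induction m with
    | zero => rfl
    | succ m ih =>
      simp only at ih ⊢
      rw [ih, ← code_next]
      rfl

/-- Here the depth is constant and the inner formula varies: this serves the first block, while the
second has variable length. -/
theorem primrec_code_ones_of_primrec (p : Fin n) {f : ℕ → Formula n}
    (hf : Primrec fun x => (f x).code) (m : ℕ) : Primrec fun x => (ones p (f x) m).code := by
  induction m with
  | zero => exact hf
  | succ m ih => exact primrec_code_and (.const _) (primrec_code_next p ih)

theorem primrec_code_neg_solutionFormula (p : Fin n) {k g : ℕ} (A : DPDA n k g) (b : ℕ)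
    {N : ℕ → ℕ} (hN : Primrec N) :
    Primrec fun x => (Formula.neg (solutionFormula p A b (N x))).code := by
  have h : Primrec fun x => (solutionFormula p A b (N x)).code :=
    primrec_code_and (primrec_code_ones_of_primrec p (primrec_code_and (.const _)
      (primrec_code_next p ((primrec_code_ones p _).comp hN))) b) (.const _)
  exact Primrec.encode.comp (.pair (.const _) h)

/-- The validity of the members of some primitive recursive family of formulas is undecidable. -/
theorem exists_undecidable_formulas (hn : 0 < n) :
    ∃ φ : ℕ → Formula n, (Primrec fun x => (φ x).code) ∧
      ¬ ComputablePred fun x => (φ x).Valid := by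
  obtain ⟨M, F, b, N, hM, hF, hN, hund⟩ := exists_undecidable_recurrence
  let p : Fin n := ⟨0, hn⟩
  obtain ⟨k, A, hA⟩ := exists_recurrence_automaton p hM hF
  -- Validity of the negation means that the recurrence has no solution, so the undecidable
  -- predicate is its complement.
  refine ⟨fun x => .neg (solutionFormula p A b (N x)), primrec_code_neg_solutionFormula p A b hN,
    fun h => hund (h.not.of_eq fun x => ?_)⟩
  rw [← exists_word_iff_exists_sequence p]
  simp only [← models_solutionFormula p hA]
  simp [Formula.Valid, Formula.Models, Formula.Sat]

theorem DecidableProblem.computablePred {I : Type} {code : I → ℕ} {yes : I → Prop}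
    (h : DecidableProblem code yes) {r : ℕ → I} (hr : Primrec fun x => code (r x)) :
    ComputablePred fun x => yes (r x) := by
  classical
  obtain ⟨f, hf, hfy⟩ := h
  refine ⟨Classical.decPred _, (hf.comp hr.to_comp).of_eq fun x => ?_⟩
  rw [Bool.eq_iff_iff, decide_eq_true_iff]
  exact hfy _

end Validity

/-! ## Universal systems -/

section Systems

variable {n : ℕ}

/-- The letters of a given kind. -/
noncomputable def lettersOfKind (kind : Letter n → LetterKind) (κ : LetterKind) :
    List (Letter n) :=
  open Classical in (Finset.univ.filter fun a => kind a = κ).toList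

theorem mem_lettersOfKind {kind : Letter n → LetterKind} {κ : LetterKind} {a : Letter n} :
    a ∈ lettersOfKind kind κ ↔ kind a = κ := by
  simp [lettersOfKind]

/-- The one-state visibly pushdown system that has all words as traces. -/
noncomputable def universalVPS (kind : Letter n → LetterKind) : VPS kind 1 1 where
  callTrans := (lettersOfKind kind .call).map fun a => (0, a, 0, 0)
  retTrans := (lettersOfKind kind .ret).map (fun a => (0, a, none, 0)) ++
    (lettersOfKind kind .ret).map fun a => (0, a, some 0, 0)
  locTrans := (lettersOfKind kind .loc).map fun a => (0, a, 0)
  call_kind := by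
    simp only [List.mem_map, forall_exists_index, and_imp]
    rintro _ a ha rfl
    exact mem_lettersOfKind.1 ha
  ret_kind := by
    simp only [List.mem_append, List.mem_map]
    rintro _ (⟨a, ha, rfl⟩ | ⟨a, ha, rfl⟩) <;> exact mem_lettersOfKind.1 ha
  loc_kind := by
    simp only [List.mem_map, forall_exists_index, and_imp]
    rintro _ a ha rfl
    exact mem_lettersOfKind.1 ha

theorem universalVPS_exists_edge (kind : Letter n → LetterKind) (c : SysConf 1 1) (a : Letter n) :
    ∃ c', (universalVPS kind).Edge c a c' := by
  obtain ⟨q, st⟩ := c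
  obtain rfl : q = 0 := Subsingleton.elim _ _
  cases h : kind a with
  | call => exact ⟨(0, 0 :: st), Or.inl ⟨0, by simp [universalVPS, mem_lettersOfKind, h], rfl⟩⟩
  | ret =>
    cases st with
    | nil =>
      exact ⟨(0, []), Or.inr (Or.inl ⟨by simp [universalVPS, mem_lettersOfKind, h], rfl, rfl⟩)⟩
    | cons A st =>
      obtain rfl : A = 0 := Subsingleton.elim _ _
      exact ⟨(0, st), Or.inr (Or.inr (Or.inl
        ⟨0, by simp [universalVPS, mem_lettersOfKind, h], rfl⟩))⟩
  | loc =>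
    exact ⟨(0, st), Or.inr (Or.inr (Or.inr
      ⟨by simp [universalVPS, mem_lettersOfKind, h], rfl⟩))⟩

/-- The one-state pushdown system that has all words as traces. -/
noncomputable def universalPDS (n : ℕ) : PDS n 1 1 where
  trans := (Finset.univ : Finset (Option (Fin 1) × Letter n)).toList.map fun x =>
    (0, x.1, x.2, 0, [x.1])
  len_le := by
    simp only [List.mem_map, forall_exists_index, and_imp]
    rintro _ x - rfl
    simp

theorem universalPDS_exists_edge (c : SysConf 1 1) (a : Letter n) :
    ∃ c', (universalPDS n).Edge c a c' := by
  obtain ⟨q, st⟩ := c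
  obtain rfl : q = 0 := Subsingleton.elim _ _
  obtain ⟨A, rest, h⟩ := List.exists_cons_of_ne_nil
    (show st.map some ++ [(none : Option (Fin 1))] ≠ [] by simp)
  exact ⟨(0, st), A, [A], rest, by simp [universalPDS], h, h⟩

/-- No configuration blocks any letter, so edges can be chosen greedily along `α`. -/
theorem exists_run_of_exists_edge {edge : SysConf 1 1 → Letter n → SysConf 1 1 → Prop}
    (h : ∀ c a, ∃ c', edge c a c') (α : Word n) :
    ∃ ρ : ℕ → SysConf 1 1, ρ 0 = (0, []) ∧ ∀ i, edge (ρ i) (α i) (ρ (i + 1)) := by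
  choose f hf using h
  exact ⟨fun i => Nat.rec (0, []) (fun i c => f c (α i)) i, rfl, fun i => hf _ _⟩

theorem universalVPS_holds_iff (kind : Letter n → LetterKind) (φ : Formula n) :
    MCInstance.Holds ⟨1, 1, universalVPS kind, 0, φ⟩ ↔ φ.Valid :=
  ⟨fun h α => h (exists_run_of_exists_edge (universalVPS_exists_edge kind) α), fun h α _ => h α⟩

/-- If all positions belong to Player 1, who can produce every word, then Player 0 wins if and only
if the winning condition is valid. -/
theorem playerZeroWins_configGame_iff {edge : SysConf 1 1 → Letter n → SysConf 1 1 → Prop}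
    (h : ∀ c a, ∃ c', edge c a c') (φ : Formula n) :
    (configGame edge ∅ 0 φ).PlayerZeroWins ↔ φ.Valid := by
  constructor
  · rintro ⟨σ, -, hσ⟩ α
    obtain ⟨ρ, h0, hρ⟩ := exists_run_of_exists_edge h α
    -- A vertex stores the label of the edge that led to it, so `α` is shifted by one, behind the
    -- fixed letter of the initial vertex.
    let a : ℕ → Letter n := fun i => Nat.casesOn i ∅ α
    exact hσ (fun i => (ρ i, a i)) ⟨Prod.ext h0 rfl, hρ⟩
      fun m hm => absurd hm (Finset.notMem_empty _)
  · intro hφ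
    -- Player 0 owns no vertex, so any function is a strategy for her.
    exact ⟨fun _ v => v, fun _ v hv => absurd hv (Finset.notMem_empty _), fun π _ _ => hφ _⟩

end Systems

end DPLDL

/-! ### Undecidability of the four problems. -/

theorem mainTheorem12 (n : ℕ) (hn : 0 < n) (kind : DPLDL.Letter n → DPLDL.LetterKind) :
    ¬ DPLDL.DecidableProblem (DPLDL.Formula.code (n := n)) DPLDL.Formula.Valid ∧
    ¬ DPLDL.DecidableProblem (DPLDL.MCInstance.code (kind := kind)) DPLDL.MCInstance.Holds ∧
    ¬ DPLDL.DecidableProblem (DPLDL.PDGame.code (n := n)) DPLDL.PDGame.PlayerZeroWins ∧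
    ¬ DPLDL.DecidableProblem (DPLDL.VPGame.code (kind := kind)) DPLDL.VPGame.PlayerZeroWins := by
  obtain ⟨φ, hφ, hund⟩ := DPLDL.exists_undecidable_formulas hn
  refine ⟨fun h => hund (h.computablePred hφ), fun h => hund ?_, fun h => hund ?_,
    fun h => hund ?_⟩
  -- In each reduction only the formula varies with `x`; the code of the system is a constant.
  · refine (h.computablePred (r := fun x => ⟨1, 1, DPLDL.universalVPS kind, 0, φ x⟩) ?_).of_eq
      fun x => DPLDL.universalVPS_holds_iff kind (φ x)
    exact Primrec.encode.comp (.pair (.const _) (.pair (.const _)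
      (.pair (.const (DPLDL.universalVPS kind).code) (.pair (.const _) hφ))))
  · refine (h.computablePred (r := fun x => ⟨1, 1, DPLDL.universalPDS n, ∅, 0, φ x⟩) ?_).of_eq
      fun x => DPLDL.playerZeroWins_configGame_iff DPLDL.universalPDS_exists_edge (φ x)
    exact Primrec.encode.comp (.pair (.const _) (.pair (.const _)
      (.pair (.const (DPLDL.universalPDS n).code) (.pair (.const (DPLDL.bits (∅ : Finset (Fin 1))))
      (.pair (.const _) hφ)))))
  · refine (h.computablePred (r := fun x => ⟨1, 1, DPLDL.universalVPS kind, ∅, 0, φ x⟩) ?_).of_eq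
      fun x => DPLDL.playerZeroWins_configGame_iff (DPLDL.universalVPS_exists_edge kind) (φ x)
    exact Primrec.encode.comp (.pair (.const _) (.pair (.const _)
      (.pair (.const (DPLDL.universalVPS kind).code) (.pair (.const (DPLDL.bits (∅ : Finset (Fin 1))))
      (.pair (.const _) hφ)))))
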